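/- Let $n\in\mathbb N$, let $\mathbb T^n=\mathbb R^n/\mathbb Z^n$ carry its Haar probability measure, $\mathbb Z^n$ the counting measure, and write $M_wT_mg(k)=e^{2\pi i w\cdot k}g(k-m)$ and $V_gf(m,w)=\sum_{k\in\mathbb Z^n}f(k)\overline{g(k-m)}e^{-2\pi i w\cdot k}$. For a function $F$ on $\mathbb Z^n\times\mathbb T^n$ and a window $\gamma$ put $$V_\gamma F(m,\omega,\xi,k)=\sum_{j\in\mathbb Z^n}\int_{\mathbb T^n}e^{-2\pi i j\cdot\xi}e^{-2\pi i\eta\cdot k}F(j,\eta)\overline{\gamma(j-m,\eta-\omega)}\,d\eta .$$ Let $\Phi:[0,\infty]\to[0,\infty]$ be a Young function (convex, $\Phi(0)=0$, $\lim_{t\to\infty}\Phi(t)=\Phi(\infty)=\infty$) with $\Phi(x)=-x^2\log x$ for $0\le x\le e^{-3/2}$. Fix non-zero windows $\gamma\in\mathcal S(\mathbb Z^n\times\mathbb T^n)$ and $g_0\in\mathcal S(\mathbb Z^n)$. The space $M^1(\mathbb Z^n\times\mathbb T^n)$ consists of the tempered $\varsigma$ (measurable functions on $\mathbb Z^n\times\mathbb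 T^n$ defining a tempered distribution) with $\|\varsigma\|_{M^1}=\|V_\gamma\varsigma\|_{L^1}<\infty$, and $M^\Phi(\mathbb Z^n)$ consists of the $g\in\mathcal S'(\mathbb Z^n)$ with $$\|g\|_{M^\Phi}=\|V_{g_0}g\|_{L^\Phi}=\inf\Big\{b>0:\ \sum_{m\in\mathbb Z^n}\int_{\mathbb T^n}\Phi\big(|V_{g_0}g(m,w)|/b\big)\,dw\le1\Big\}<\infty .$$ Let $\varsigma\in M^1(\mathbb Z^n\times\mathbb T^n)$ and $g\in M^\Phi(\mathbb Z^n)$. Then for all $f\in\ell^2(\mathbb Z^n)$ and $k\in\mathbb Z^n$ the series $V_gf$ and the expression $$\mathfrak L^{g,g}_\varsigma f(k)=\sum_{m\in\mathbb Z^n}\int_{\mathbb T^n}\varsigma(m,w)\,V_gf(m,w)\,M_wT_mg(k)\,dw$$ converge absolutely, and this defines a bounded operator $\mathfrak L^{g,g}_\varsigma:\ell^2(\mathbb Z^n)\to\ell^2(\mathbb Z^n)$ that belongs to the Schatten class $S_1$ (it is compact, and the sum $\|\mathfrak L^{g,g}_\varsigma\|_{S_1}$ of its singular values, with multiplicity,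 is finite). If the windows are normalized so that $\|\gamma\|_\infty\|g_0\|_{\ell^2}^2\ge\frac43$, then $$\|\mathfrak L^{g,g}_\varsigma\|_{S_1}\le4\,\|\varsigma\|_{M^1(\mathbb Z^n\times\mathbb T^n)}\,\|g\|^2_{M^\Phi(\mathbb Z^n)} .$$ For arbitrary non-zero windows, $$\tfrac34\,\|\gamma\|_\infty\,\|g_0\|_{\ell^2}^2\,\|\mathfrak L^{g,g}_\varsigma\|_{S_1}\le4\,\|\varsigma\|_{M^1(\mathbb Z^n\times\mathbb T^n)}\,\|g\|^2_{M^\Phi(\mathbb Z^n)} .$$ -/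

import Mathlib

open MeasureTheory Filter Topology
open scoped ENNReal NNReal ComplexConjugate

noncomputable section

namespace OrliczLoc

/-- The lattice `ℤⁿ`. -/
abbrev Zn (n : ℕ) : Type := Fin n → ℤ

/-- The torus `𝕋ⁿ = (ℝ/ℤ)ⁿ`. -/
abbrev Tn (n : ℕ) : Type := UnitAddTorus (Fin n)

/-- The Haar probability measure on `𝕋ⁿ`. -/
def muT (n : ℕ) : Measure (Tn n) := Measure.pi fun _ => AddCircle.haarAddCircle

/-- The Hilbert space `ℓ²(ℤⁿ)`. -/
abbrev ellTwo (n : ℕ) : Type := lp (fun _ : Zn n => ℂ) 2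

/-- Counting measure times Haar measure on `ℤⁿ × 𝕋ⁿ`. -/
def muZT (n : ℕ) : Measure (Zn n × Tn n) :=
  (Measure.count : Measure (Zn n)).prod (muT n)

/-- Haar measure on the dual group `𝕋ⁿ × ℤⁿ` of `ℤⁿ × 𝕋ⁿ`. -/
def muTZ (n : ℕ) : Measure (Tn n × Zn n) :=
  (muT n).prod (Measure.count : Measure (Zn n))

/-- The character `e^{2πi k·w}` of `ℤⁿ × 𝕋ⁿ`. -/
def character {n : ℕ} (k : Zn n) (w : Tn n) : ℂ := UnitAddTorus.mFourier k w

/-! ### Schwartz functions and tempered distributions -/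

/-- The Schwartz space `𝒮(ℤⁿ)` of rapidly decreasing functions. -/
def IsSchwartzZ {n : ℕ} (g : Zn n → ℂ) : Prop :=
  ∀ N : ℕ, ∃ C : ℝ, ∀ k, (1 + ‖k‖) ^ N * ‖g k‖ ≤ C

/-- The dual `𝒮'(ℤⁿ)`, each functional being identified with the function `k ↦ f(δ_k)`: these are
exactly the functions of at most polynomial growth. -/
def IsTemperedZ {n : ℕ} (f : Zn n → ℂ) : Prop :=
  ∃ (C : ℝ) (N : ℕ), ∀ k, ‖f k‖ ≤ C * (1 + ‖k‖) ^ N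

/-- The `ℤⁿ`-periodic lift to `ℝⁿ` of the slice `F(j, ·)`. -/
def liftSlice {n : ℕ} (F : Zn n × Tn n → ℂ) (j : Zn n) (x : Fin n → ℝ) : ℂ :=
  F (j, fun i => (x i : UnitAddCircle))

/-- The Schwartz space `𝒮(ℤⁿ × 𝕋ⁿ)`: smooth in the torus variable, with all derivatives rapidly
decreasing in the lattice variable. -/
def IsSchwartzZT {n : ℕ} (F : Zn n × Tn n → ℂ) : Prop :=
  (∀ j, ContDiff ℝ (⊤ : ℕ∞) (liftSlice F j)) ∧
    ∀ N r : ℕ, ∃ C : ℝ, ∀ j x, (1 + ‖j‖) ^ N * ‖iteratedFDeriv ℝ r (liftSlice F j) x‖ ≤ C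

/-- Measurable functions on `ℤⁿ × 𝕋ⁿ` that define a tempered distribution `φ ↦ ∑_j ∫ F φ`
(absolutely convergent for every Schwartz `φ`): the `L¹(𝕋ⁿ)` norms of the slices grow at most
polynomially. -/
def IsTemperedZT {n : ℕ} (F : Zn n × Tn n → ℂ) : Prop :=
  AEStronglyMeasurable F (muZT n) ∧
    ∃ (C : ℝ) (N : ℕ), ∀ j, ∫⁻ η, ‖F (j, η)‖ₑ ∂(muT n) ≤ ENNReal.ofReal (C * (1 + ‖j‖) ^ N)

/-! ### Short-time Fourier transforms -/

/-- The STFT on `ℤⁿ`: `V_g f(m, w) = ∑_k f(k) conj(g(k - m)) e^{-2πi w·k}`. -/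
def stft {n : ℕ} (g f : Zn n → ℂ) (p : Zn n × Tn n) : ℂ :=
  ∑' k, f k * conj (g (k - p.1)) * character (-k) p.2

/-- The STFT on `ℤⁿ × 𝕋ⁿ`, at the point `((m, ω), (ξ, k))`. -/
def stftZT {n : ℕ} (γ F : Zn n × Tn n → ℂ) (q : (Zn n × Tn n) × (Tn n × Zn n)) : ℂ :=
  ∑' j : Zn n, ∫ η : Tn n, character (-j) q.2.1 * character (-q.2.2) η * F (j, η) *
    conj (γ (j - q.1.1, η - q.1.2)) ∂(muT n)

/-! ### Young functions and Orlicz spaces -/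

/-- Young functions `Φ : [0, ∞] → [0, ∞]`. -/
structure IsYoung (Φ : ℝ≥0∞ → ℝ≥0∞) : Prop where
  convex : ∀ x₁ x₂ y₁ y₂ : ℝ≥0, x₁ + x₂ = 1 →
    Φ (x₁ * y₁ + x₂ * y₂) ≤ x₁ * Φ y₁ + x₂ * Φ y₂
  map_zero : Φ 0 = 0
  tendsto_top : Tendsto (fun t : ℝ≥0 => Φ t) atTop (𝓝 ∞)
  map_top : Φ ∞ = ∞

/-- `Φ(x) = -x² log x` for `0 ≤ x ≤ e^{-3/2}`. -/
def EntropyNearZero (Φ : ℝ≥0∞ → ℝ≥0∞) : Prop :=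
  ∀ x : ℝ, 0 ≤ x → x ≤ Real.exp (-(3 / 2)) →
    Φ (ENNReal.ofReal x) = ENNReal.ofReal (-(x ^ 2 * Real.log x))

/-- The Luxemburg norm `inf {b > 0 : ∫ Φ(|F| / b) ≤ 1}` of `L^Φ(μ)`; it is `∞` when there is no
such `b`. -/
def orliczNorm {X : Type*} [MeasurableSpace X] (Φ : ℝ≥0∞ → ℝ≥0∞) (μ : Measure X) (F : X → ℂ) :
    ℝ≥0∞ :=
  ⨅ (b : ℝ≥0) (_ : 0 < b ∧ ∫⁻ x, Φ (‖F x‖ₑ / b) ∂μ ≤ 1), (b : ℝ≥0∞)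

/-! ### Modulation spaces -/

/-- The norm of `M^Φ(ℤⁿ)` with window `g₀`. -/
def mPhiNorm {n : ℕ} (Φ : ℝ≥0∞ → ℝ≥0∞) (g₀ f : Zn n → ℂ) : ℝ≥0∞ :=
  orliczNorm Φ (muZT n) (stft g₀ f)

/-- The Orlicz modulation space `M^Φ(ℤⁿ)`, with window `g₀`. -/
def MemMPhi {n : ℕ} (Φ : ℝ≥0∞ → ℝ≥0∞) (g₀ f : Zn n → ℂ) : Prop :=
  IsTemperedZ f ∧ mPhiNorm Φ g₀ f < ∞

/-- The norm of `M¹(ℤⁿ × 𝕋ⁿ)` with window `γ`. -/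
def m1Norm {n : ℕ} (γ F : Zn n × Tn n → ℂ) : ℝ≥0∞ :=
  eLpNorm (stftZT γ F) 1 ((muZT n).prod (muTZ n))

/-- The modulation space `M¹(ℤⁿ × 𝕋ⁿ)`, with window `γ`. -/
def MemM1 {n : ℕ} (γ F : Zn n × Tn n → ℂ) : Prop :=
  IsTemperedZT F ∧ MemLp (stftZT γ F) 1 ((muZT n).prod (muTZ n))

/-! ### Localization operators and the trace class -/

/-- The integrand `ς(m, w) V_{g₁}f(m, w) (M_w T_m g₂)(k)`, as a function of `(m, w)`. -/
def locIntegrand {n : ℕ} (ς : Zn n × Tn n → ℂ) (g₁ g₂ f : Zn n → ℂ) (k : Zn n)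
    (p : Zn n × Tn n) : ℂ :=
  ς p * stft g₁ f p * (character k p.2 * g₂ (k - p.1))

/-- `𝔏_ς^{g₁,g₂} f(k) = ∑_m ∫ ς(m, w) V_{g₁}f(m, w) (M_w T_m g₂)(k) dw`. -/
def locOp {n : ℕ} (ς : Zn n × Tn n → ℂ) (g₁ g₂ f : Zn n → ℂ) (k : Zn n) : ℂ :=
  ∑' m : Zn n, ∫ w : Tn n, locIntegrand ς g₁ g₂ f k (m, w) ∂(muT n)

section Schatten

variable {H : Type*} [NormedAddCommGroup H] [InnerProductSpace ℂ H] [CompleteSpace H]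

/-- The sum of the singular values of a compact operator `A`, that is, of the non-zero eigenvalues
of `|A| = √(A* A)`, each counted with its multiplicity. -/
def s1Norm (A : H →L[ℂ] H) : ℝ≥0∞ :=
  ∑' s : {s : ℝ // 0 < s}, ENNReal.ofReal s.1 * (Module.finrank ℂ
    (Module.End.eigenspace ((CFC.abs A : H →L[ℂ] H) : H →ₗ[ℂ] H) (s.1 : ℂ)) : ℝ≥0∞)

/-- The Schatten–von Neumann class `S₁`: compact operators with summable singular values. -/
def MemS1 (A : H →L[ℂ] H) : Prop :=
  IsCompactOperator A ∧ s1Norm A < ∞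

end Schatten

end OrliczLoc

end

namespace OrliczLoc

variable {n : ℕ}

/-! The operator is the superposition `∫ ς(z) ⟨π(z)g, ·⟩ π(z)g dz` of rank-one operators, where
`π(z)g = M_w T_m g` has norm `‖g‖₂`. Each rank-one operator has trace norm `‖g‖₂²`, so the trace
norm of the whole is at most `‖ς‖₁ ‖g‖₂²` (`s1Norm_locCLM_le`). What remains is two embeddings with
explicit constants.

`M¹ ⊂ L¹` (`iSup_enorm_mul_lintegral_le_m1Norm`): for fixed `z`, the function `ς · conj γ(· - z)` is
bounded a.e. by the `L¹` norm `h(z)` of its Fourier transform. Integrating `|ς(p)||γ(p - z)| ≤ h(z)`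
over `p` and `z` with `p - z` confined to a small set near a point where `|γ|` almost attains its
supremum gives `‖γ‖_∞ ‖ς‖₁ ≤ ‖ς‖_{M¹}`.

`M^Φ ⊂ ℓ²` (`MemMPhi.memℓp`, `three_mul_enorm_sq_le_mPhiNorm`): by orthogonality `∫ |V_{g₀}g|² =
‖g₀‖₂² ‖g‖₂²`, and `V_{g₀}g` is bounded, so a lower bound `D x² ≤ Φ(x)` on a bounded interval is
enough. Convexity provides it: beyond `e^{-3/2}`, `Φ` stays above a secant of `-x² log x`. The
outcome is `3 ‖g₀‖₂² ‖g‖₂² ≤ 16 ‖g‖²_{M^Φ}`, and `16/3 = 4 · 4/3` explains the normalization of the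
windows. -/

instance : IsProbabilityMeasure (muT n) := by unfold muT; infer_instance

instance : (muT n).IsAddHaarMeasure := by unfold muT; infer_instance

/-! ### Characters -/

lemma norm_character (k : Zn n) (w : Tn n) : ‖character k w‖ = 1 := by
  simp only [character, UnitAddTorus.mFourier, ContinuousMap.coe_mk, fourier_apply, norm_prod,
    Circle.norm_coe, Finset.prod_const_one]

lemma enorm_character (k : Zn n) (w : Tn n) : ‖character k w‖ₑ = 1 := by
  rw [← ofReal_norm, norm_character, ENNReal.ofReal_one]

lemma continuous_character (k : Zn n) : Continuous (character k) :=
  (UnitAddTorus.mFourier k).continuous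

lemma character_neg (k : Zn n) (w : Tn n) : character (-k) w = conj (character k w) :=
  UnitAddTorus.mFourier_neg

lemma character_add (k l : Zn n) (w : Tn n) :
    character (k + l) w = character k w * character l w :=
  UnitAddTorus.mFourier_add

lemma character_zero (w : Tn n) : character 0 w = 1 := by
  simp [character, UnitAddTorus.mFourier_zero]

lemma character_neg_mul_character (k : Zn n) (w : Tn n) :
    character (-k) w * character k w = 1 := by
  rw [← character_add, neg_add_cancel, character_zero]

lemma integral_character (k : Zn n) :
    ∫ w, character k w ∂(muT n) = if k = 0 then 1 else 0 := by
  split_ifs with h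
  · simp [h, character_zero]
  · obtain ⟨i, hi⟩ := Function.ne_iff.mp h
    have h1 : ∫ w, character k w ∂(muT n)
        = ∏ i, ∫ x : UnitAddCircle, fourier (k i) x ∂AddCircle.haarAddCircle := by
      simp only [character, UnitAddTorus.mFourier, ContinuousMap.coe_mk, muT]
      exact integral_fintype_prod_eq_prod (𝕜 := ℂ) (fun i (x : UnitAddCircle) => fourier (k i) x)
    rw [h1]
    refine Finset.prod_eq_zero (Finset.mem_univ i) ?_
    have h2 := orthonormal_iff_ite.mp (orthonormal_fourier (T := 1)) 0 (k i)
    rw [if_neg (fun h => hi h.symm)] at h2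
    simpa only [ContinuousMap.inner_toLp, ← fourier_neg, ← fourier_add, neg_zero, add_zero,
      zero_add] using h2

/-! ### Absolutely convergent Fourier series -/

section Series

variable {c : Zn n → ℂ}

lemma continuous_tsum_mul_character (hc : Summable fun k => ‖c k‖) :
    Continuous fun w : Tn n => ∑' k, c k * character k w := by
  refine continuous_tsum (fun k => (continuous_character k).const_mul _) hc fun k w => ?_
  simp [norm_character]

lemma norm_tsum_mul_character_le (hc : Summable fun k => ‖c k‖) (w : Tn n) :
    ‖∑' k, c k * character k w‖ ≤ ∑' k, ‖c k‖ := by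
  refine (norm_tsum_le_tsum_norm ?_).trans_eq ?_ <;> simp [norm_character, hc]

lemma integral_mul_tsum_character {ψ : Tn n → ℂ} (hψ : Integrable ψ (muT n))
    (hc : Summable fun k => ‖c k‖) :
    ∫ w, ψ w * ∑' k, c k * character k w ∂(muT n)
      = ∑' k, c k * ∫ w, ψ w * character k w ∂(muT n) := by
  have hi : ∀ k, Integrable (fun w => ψ w * (c k * character k w)) (muT n) := fun k =>
    hψ.mul_bdd (c := ‖c k‖) ((continuous_character k).const_mul _).aestronglyMeasurable
      (Eventually.of_forall fun w => by simp [norm_character])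
  have h := integral_tsum_of_summable_integral_norm hi (by
    simp only [norm_mul, norm_character, mul_one, integral_mul_const]
    exact hc.mul_left _)
  simp_rw [← tsum_mul_left]
  rw [← h]
  refine tsum_congr fun k => ?_
  rw [← integral_const_mul]
  exact integral_congr_ae (Eventually.of_forall fun w => by ring)

lemma integrable_character (k : Zn n) : Integrable (character k) (muT n) :=
  Integrable.of_bound (continuous_character k).aestronglyMeasurable 1
    (Eventually.of_forall fun w => (norm_character k w).le)

/-- The Fourier coefficients of an absolutely convergent Fourier series. -/
lemma integral_character_neg_mul_tsum (hc : Summable fun k => ‖c k‖) (l : Zn n) :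
    ∫ w, character (-l) w * ∑' k, c k * character k w ∂(muT n) = c l := by
  rw [integral_mul_tsum_character (integrable_character _) hc, tsum_eq_single l]
  · simp [character_neg_mul_character]
  · intro k hk
    simp_rw [← character_add]
    rw [integral_character, if_neg, mul_zero]
    intro h
    exact hk (neg_add_eq_zero.mp h).symm

/-- Parseval's identity for an absolutely convergent Fourier series. -/
lemma lintegral_tsum_mul_character_sq (hc : Summable fun k => ‖c k‖) :
    ∫⁻ w, ‖∑' k, c k * character k w‖ₑ ^ 2 ∂(muT n) = ∑' k, ‖c k‖ₑ ^ 2 := by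
  set F : Tn n → ℂ := fun w => ∑' k, c k * character k w with hF
  have hFc : Continuous F := continuous_tsum_mul_character hc
  have hb : ∀ w, ‖F w‖ ≤ ∑' k, ‖c k‖ := norm_tsum_mul_character_le hc
  have hFi : Integrable (fun w => conj (F w)) (muT n) :=
    Integrable.of_bound hFc.star.aestronglyMeasurable (∑' k, ‖c k‖)
      (Eventually.of_forall fun w => by simpa using hb w)
  have h1 : ∫ w, conj (F w) * F w ∂(muT n) = ∑' k, ((‖c k‖ ^ 2 : ℝ) : ℂ) := by
    -- Only one factor of `|F|²` is expanded; the other, kept as a bounded function, yields the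
    -- conjugate coefficients.
    rw [hF, integral_mul_tsum_character hFi hc]
    refine tsum_congr fun k => ?_
    have : ∫ w, conj (F w) * character k w ∂(muT n) = conj (c k) := by
      rw [← integral_character_neg_mul_tsum hc k, ← integral_conj]
      refine integral_congr_ae (Eventually.of_forall fun w => ?_)
      simp [character_neg, hF, mul_comm]
    rw [this, RCLike.mul_conj]; simp
  have hsq : Summable fun k => ‖c k‖ ^ 2 := by
    refine Summable.of_nonneg_of_le (fun _ => by positivity) (fun k => ?_) (hc.mul_left (∑' k, ‖c k‖))
    rw [sq]
    exact mul_le_mul_of_nonneg_right (hc.le_tsum k fun _ _ => norm_nonneg _) (norm_nonneg _)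
  have h2 : ∫ w, ‖F w‖ ^ 2 ∂(muT n) = ∑' k, ‖c k‖ ^ 2 := by
    have : ∫ w, ((‖F w‖ ^ 2 : ℝ) : ℂ) ∂(muT n) = ((∑' k, ‖c k‖ ^ 2 : ℝ) : ℂ) := by
      rw [Complex.ofReal_tsum, ← h1]
      refine integral_congr_ae (Eventually.of_forall fun w => ?_)
      simp [RCLike.conj_mul]
    rw [integral_complex_ofReal] at this
    exact_mod_cast this
  have h3 : Integrable (fun w => ‖F w‖ ^ 2) (muT n) :=
    Integrable.of_bound (hFc.norm.pow 2).aestronglyMeasurable ((∑' k, ‖c k‖) ^ 2)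
      (Eventually.of_forall fun w => by
        rw [norm_pow, norm_norm]; exact pow_le_pow_left₀ (norm_nonneg _) (hb w) 2)
  have h4 := ofReal_integral_eq_lintegral_ofReal h3 (Eventually.of_forall fun w => by positivity)
  rw [h2, ENNReal.ofReal_tsum_of_nonneg (fun _ => by positivity) hsq] at h4
  simp only [← ENNReal.ofReal_pow (norm_nonneg _), ← ofReal_norm]
  exact h4.symm

end Series

/-! ### Uniqueness of Fourier coefficients -/

/-- The functional `φ ↦ ∫ φF` is continuous on `C(𝕋ⁿ)` and vanishes on trigonometric polynomials,
which are dense. Continuous approximations of indicators then give `∫_s F = 0` for every closed `s`.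
-/
lemma ae_eq_zero_of_integral_character_eq_zero {F : Tn n → ℂ} (hF : Integrable F (muT n))
    (h0 : ∀ k, ∫ η, character k η * F η ∂(muT n) = 0) : F =ᵐ[muT n] 0 := by
  have hint : ∀ φ : C(Tn n, ℂ), Integrable (fun η => φ η * F η) (muT n) := fun φ =>
    hF.bdd_mul (c := ‖φ‖) φ.continuous.aestronglyMeasurable
      (Eventually.of_forall fun η => φ.norm_coe_le_norm η)
  let T : C(Tn n, ℂ) →L[ℂ] ℂ := LinearMap.mkContinuous
    { toFun := fun φ => ∫ η, φ η * F η ∂(muT n)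
      map_add' := fun φ ψ => by
        simp only [ContinuousMap.add_apply, add_mul]
        exact integral_add (hint φ) (hint ψ)
      map_smul' := fun a φ => by
        simp only [ContinuousMap.smul_apply, smul_eq_mul, mul_assoc, RingHom.id_apply]
        exact integral_const_mul _ _ } (∫ η, ‖F η‖ ∂(muT n)) (fun φ => by
      simp only [LinearMap.coe_mk, AddHom.coe_mk]
      rw [mul_comm, ← integral_const_mul]
      refine norm_integral_le_of_norm_le (hF.norm.const_mul _) (Eventually.of_forall fun η => ?_)
      rw [norm_mul]
      exact mul_le_mul_of_nonneg_right (φ.norm_coe_le_norm η) (norm_nonneg _))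
  have hT : ∀ φ : C(Tn n, ℂ), ∫ η, φ η * F η ∂(muT n) = 0 := by
    intro φ
    have hle : (Submodule.span ℂ (Set.range <| UnitAddTorus.mFourier (d := Fin n))).topologicalClosure
        ≤ LinearMap.ker (T : C(Tn n, ℂ) →ₗ[ℂ] ℂ) := by
      refine Submodule.topologicalClosure_minimal _ (Submodule.span_le.mpr ?_) T.isClosed_ker
      rintro _ ⟨k, rfl⟩
      exact h0 k
    rw [UnitAddTorus.span_mFourier_closure_eq_top] at hle
    exact hle (Submodule.mem_top (x := φ))
  refine ae_eq_zero_of_forall_setIntegral_isClosed_eq_zero hF fun s hs => ?_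
  have h1 : ∀ m : ℕ, ∫ η, ((hs.apprSeq m η : ℝ) : ℂ) * F η ∂(muT n) = 0 := fun m =>
    hT ⟨fun η => ((hs.apprSeq m η : ℝ) : ℂ), by fun_prop⟩
  have h2 : Tendsto (fun m : ℕ => ∫ η, ((hs.apprSeq m η : ℝ) : ℂ) * F η ∂(muT n)) atTop
      (𝓝 (∫ η, s.indicator F η ∂(muT n))) := by
    refine tendsto_integral_of_dominated_convergence (fun η => ‖F η‖)
      (fun m => ((by fun_prop : Continuous fun η => ((hs.apprSeq m η : ℝ) : ℂ)).aestronglyMeasurable).mul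
        hF.aestronglyMeasurable) hF.norm ?_ ?_
    · refine fun m => Eventually.of_forall fun η => ?_
      rw [norm_mul, Complex.norm_real]
      refine mul_le_of_le_one_left (norm_nonneg _) ?_
      have := HasOuterApproxClosed.apprSeq_apply_le_one hs m η
      simpa using this
    · refine Eventually.of_forall fun η => ?_
      have h3 := (tendsto_pi_nhds.mp (HasOuterApproxClosed.tendsto_apprSeq hs)) η
      have h4 : Tendsto (fun m => ((hs.apprSeq m η : ℝ) : ℂ) * F η) atTop
          (𝓝 ((((s.indicator (fun _ => (1 : ℝ≥0)) η : ℝ≥0) : ℝ) : ℂ) * F η)) :=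
        (((Complex.continuous_ofReal.comp NNReal.continuous_coe).tendsto _).comp h3).mul_const _
      convert h4 using 2
      by_cases hη : η ∈ s <;> simp [hη]
  rw [← integral_indicator hs.measurableSet]
  simp only [h1] at h2
  exact (tendsto_nhds_unique h2 tendsto_const_nhds)

/-- An integrable function with absolutely summable Fourier coefficients is essentially bounded by
the sum of their moduli. -/
lemma ae_enorm_le_tsum_enorm_coeff {F : Tn n → ℂ} (hF : Integrable F (muT n)) :
    ∀ᵐ η ∂(muT n), ‖F η‖ₑ ≤ ∑' k, ‖∫ x, character (-k) x * F x ∂(muT n)‖ₑ := by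
  set c : Zn n → ℂ := fun k => ∫ x, character (-k) x * F x ∂(muT n) with hc
  change ∀ᵐ η ∂(muT n), ‖F η‖ₑ ≤ ∑' k, ‖c k‖ₑ
  by_cases htop : ∑' k, ‖c k‖ₑ = ∞
  · simp [htop]
  have hs : Summable fun k => ‖c k‖ := by
    have := ENNReal.summable_toReal htop
    simpa using this
  set G : Tn n → ℂ := fun w => ∑' k, c k * character k w with hG
  have hGc : Continuous G := continuous_tsum_mul_character hs
  have hGi : Integrable G (muT n) := Integrable.of_bound hGc.aestronglyMeasurable (∑' k, ‖c k‖)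
    (Eventually.of_forall fun w => norm_tsum_mul_character_le hs w)
  have hint : ∀ (k : Zn n) {ψ : Tn n → ℂ}, Integrable ψ (muT n) →
      Integrable (fun η => character k η * ψ η) (muT n) := fun k ψ hψ =>
    hψ.bdd_mul (c := 1) (continuous_character k).aestronglyMeasurable
      (Eventually.of_forall fun η => (norm_character k η).le)
  -- The absolutely convergent series `G` has the same Fourier coefficients as `F`, so uniqueness
  -- applies to the difference.
  have h0 : (fun η => F η - G η) =ᵐ[muT n] 0 := by
    refine ae_eq_zero_of_integral_character_eq_zero (hF.sub hGi) fun k => ?_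
    simp only [mul_sub]
    rw [integral_sub (hint k hF) (hint k hGi)]
    have := integral_character_neg_mul_tsum hs (-k)
    rw [neg_neg] at this
    rw [hG, this, hc]
    simp
  filter_upwards [h0] with η hη
  have : F η = G η := sub_eq_zero.mp hη
  rw [this]
  refine (enorm_tsum_le_tsum_enorm (f := fun k => c k * character k η)).trans_eq ?_
  simp [enorm_mul, enorm_character]

/-! ### Summability over the lattice -/

lemma summable_int_inv_sq : Summable fun k : ℤ => ((1 + ‖k‖) ^ 2)⁻¹ := by
  refine Summable.of_norm_bounded_eventually
    (Real.summable_one_div_int_pow.mpr (by norm_num : 1 < 2)) ?_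
  rw [Filter.eventually_cofinite]
  -- The comparison with `1 / k²` fails only at `k = 0`, where that quotient is `0` by convention.
  refine (Set.finite_singleton (0 : ℤ)).subset fun k hk => ?_
  by_contra h0
  refine hk ?_
  have h0' : (k : ℝ) ≠ 0 := by exact_mod_cast h0
  rw [Real.norm_of_nonneg (by positivity), one_div, Int.norm_eq_abs]
  refine inv_anti₀ (by positivity) ?_
  rw [← sq_abs]
  exact pow_le_pow_left₀ (abs_nonneg _) (by linarith) 2

lemma summable_prod_inv_sq (n : ℕ) :
    Summable fun k : Zn n => ∏ i, ((1 + ‖k i‖) ^ 2)⁻¹ := by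
  induction n with
  | zero => exact Summable.of_finite
  | succ n ih =>
    rw [← (Fin.consEquiv fun _ : Fin (n + 1) => ℤ).summable_iff]
    have := Summable.mul_of_nonneg summable_int_inv_sq ih
      (fun _ => by positivity) (fun _ => Finset.prod_nonneg fun _ _ => by positivity)
    refine this.congr fun p => ?_
    simp [Fin.consEquiv, Fin.prod_univ_succ, mul_comm]

lemma summable_inv_one_add_norm_pow (n : ℕ) :
    Summable fun k : Zn n => ((1 + ‖k‖) ^ (2 * n))⁻¹ := by
  refine Summable.of_nonneg_of_le (fun _ => by positivity) (fun k => ?_) (summable_prod_inv_sq n)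
  rw [Finset.prod_inv_distrib]
  refine inv_anti₀ (Finset.prod_pos fun _ _ => by positivity) ?_
  calc ∏ i, (1 + ‖k i‖) ^ 2 ≤ ∏ _i : Fin n, (1 + ‖k‖) ^ 2 :=
        Finset.prod_le_prod (fun _ _ => by positivity) fun i _ =>
          pow_le_pow_left₀ (by positivity) (by linarith [norm_le_pi_norm k i]) 2
    _ = (1 + ‖k‖) ^ (2 * n) := by simp [pow_mul]

/-- A rapidly decreasing sequence remains summable after translation and multiplication by a
sequence of polynomial growth. -/
lemma summable_mul_of_decay {a b : Zn n → ℝ} {C D : ℝ} {N : ℕ} (ha0 : ∀ k, 0 ≤ a k)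
    (hb0 : ∀ k, 0 ≤ b k) (ha : ∀ k, a k ≤ C * (1 + ‖k‖) ^ N)
    (hb : ∀ k, (1 + ‖k‖) ^ (N + 2 * n) * b k ≤ D) (m : Zn n) :
    Summable fun k => a k * b (k - m) := by
  have hC : 0 ≤ C := by simpa using (ha0 0).trans (ha 0)
  have hs : Summable fun k : Zn n => ((1 + ‖k - m‖) ^ (2 * n))⁻¹ :=
    (Equiv.subRight m).summable_iff.mpr (summable_inv_one_add_norm_pow n)
  refine Summable.of_nonneg_of_le (fun k => mul_nonneg (ha0 k) (hb0 _)) (fun k => ?_)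
    (hs.mul_left (C * (1 + ‖m‖) ^ N * D))
  have hp : (0 : ℝ) < (1 + ‖k - m‖) ^ (2 * n) := by positivity
  rw [← div_eq_mul_inv, le_div_iff₀ hp]
  -- Peetre's inequality: the polynomial weight is moved from `k` to `k - m` at the price of a
  -- constant depending on `m`.
  have h1 : 1 + ‖k‖ ≤ (1 + ‖m‖) * (1 + ‖k - m‖) := by
    have : ‖k‖ ≤ ‖m‖ + ‖k - m‖ := by simpa using norm_add_le m (k - m)
    nlinarith [norm_nonneg m, norm_nonneg (k - m), mul_nonneg (norm_nonneg m) (norm_nonneg (k - m))]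
  have h2 : a k ≤ C * ((1 + ‖m‖) ^ N * (1 + ‖k - m‖) ^ N) := by
    rw [← mul_pow]
    exact (ha k).trans (mul_le_mul_of_nonneg_left (pow_le_pow_left₀ (by positivity) h1 N) hC)
  calc a k * b (k - m) * (1 + ‖k - m‖) ^ (2 * n)
      ≤ C * ((1 + ‖m‖) ^ N * (1 + ‖k - m‖) ^ N) * b (k - m) * (1 + ‖k - m‖) ^ (2 * n) := by
        gcongr
        exact hb0 _
    _ = C * (1 + ‖m‖) ^ N * ((1 + ‖k - m‖) ^ (N + 2 * n) * b (k - m)) := by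
        rw [pow_add]; ring
    _ ≤ C * (1 + ‖m‖) ^ N * D := mul_le_mul_of_nonneg_left (hb _) (by positivity)

/-! ### The measures on `ℤⁿ × 𝕋ⁿ` and `𝕋ⁿ × ℤⁿ` -/

lemma measurableEmbedding_prodMk (j : Zn n) :
    MeasurableEmbedding (Prod.mk j : Tn n → Zn n × Tn n) :=
  measurableEmbedding_prodMk_left j

lemma muZT_eq_sum : muZT n = Measure.sum fun j => (muT n).map (Prod.mk j) := by
  rw [muZT, Measure.count, Measure.prod_sum_left]
  simp only [Measure.dirac_prod]

/-- No measurability of `f` is needed, since each slice inclusion is a measurable embedding. -/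
lemma lintegral_muZT (f : Zn n × Tn n → ℝ≥0∞) :
    ∫⁻ p, f p ∂(muZT n) = ∑' j, ∫⁻ η, f (j, η) ∂(muT n) := by
  rw [muZT_eq_sum, lintegral_sum_measure]
  exact tsum_congr fun j => (measurableEmbedding_prodMk j).lintegral_map _

lemma ae_muZT_iff {P : Zn n × Tn n → Prop} :
    (∀ᵐ p ∂(muZT n), P p) ↔ ∀ j, ∀ᵐ η ∂(muT n), P (j, η) := by
  rw [muZT_eq_sum, Measure.ae_sum_iff]
  exact forall_congr' fun j => (measurableEmbedding_prodMk j).ae_map_iff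

lemma aestronglyMeasurable_slice {F : Zn n × Tn n → ℂ} (hF : AEStronglyMeasurable F (muZT n))
    (j : Zn n) : AEStronglyMeasurable (fun η => F (j, η)) (muT n) := by
  have h := hF.mono_measure (μ := muZT n) (ν := (muT n).map (Prod.mk j)) (by
    rw [muZT_eq_sum]
    exact Measure.le_sum (fun j => (muT n).map (Prod.mk j)) j)
  exact h.comp_measurable measurable_prodMk_left

lemma integrable_slice {F : Zn n × Tn n → ℂ} (hF : Integrable F (muZT n)) (j : Zn n) :
    Integrable (fun η => F (j, η)) (muT n) := by
  refine ⟨aestronglyMeasurable_slice hF.1 j, ?_⟩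
  have := hF.2
  rw [HasFiniteIntegral, lintegral_muZT] at this
  exact (ENNReal.le_tsum j).trans_lt this

lemma lintegral_muTZ (f : Tn n × Zn n → ℝ≥0∞) :
    ∫⁻ q, f q ∂(muTZ n) = ∑' k, ∫⁻ ξ, f (ξ, k) ∂(muT n) := by
  rw [muTZ, Measure.count, Measure.prod_sum_right, lintegral_sum_measure]
  refine tsum_congr fun k => ?_
  rw [Measure.prod_dirac]
  exact (measurableEmbedding_prod_mk_right k).lintegral_map _

instance : SigmaFinite (muZT n) := by unfold muZT; infer_instance

instance : SigmaFinite (muTZ n) := by unfold muTZ; infer_instance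

instance : IsFiniteMeasureOnCompacts (Measure.count : Measure (Zn n)) :=
  ⟨fun _ hK => Measure.count_apply_lt_top.mpr hK.finite_of_discrete⟩

set_option synthInstance.maxSize 1000 in
instance : MeasurableSub₂ (Zn n × Tn n) := ContinuousSub.measurableSub₂

instance : (Measure.count : Measure (Zn n)).IsAddHaarMeasure where

instance : (muZT n).IsAddHaarMeasure := Measure.prod.instIsAddHaarMeasure _ _

instance : (muT n).IsNegInvariant := by
  unfold muT
  exact Measure.pi.isNegInvariant fun _ : Fin n => (AddCircle.haarAddCircle : Measure UnitAddCircle)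

instance : (muZT n).IsNegInvariant :=
  ⟨((Measure.measurePreserving_neg (Measure.count : Measure (Zn n))).prod
    (Measure.measurePreserving_neg (muT n))).map_eq⟩

/-! ### The Fourier transform on `ℤⁿ × 𝕋ⁿ` -/

/-- The Fourier transform of `H`, as a function on `𝕋ⁿ × ℤⁿ`. -/
noncomputable def fourierZT (H : Zn n × Tn n → ℂ) (q : Tn n × Zn n) : ℂ :=
  ∑' j : Zn n, ∫ η : Tn n, character (-j) q.1 * character (-q.2) η * H (j, η) ∂(muT n)

/-- An integrable function on `ℤⁿ × 𝕋ⁿ` is essentially bounded by the `L¹` norm of its Fourier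
transform. -/
lemma ae_enorm_le_lintegral_fourierZT {H : Zn n × Tn n → ℂ} (hH : Integrable H (muZT n)) :
    ∀ᵐ p ∂(muZT n), ‖H p‖ₑ ≤ ∫⁻ q, ‖fourierZT H q‖ₑ ∂(muTZ n) := by
  set c : Zn n → Zn n → ℂ := fun k j => ∫ η, character (-k) η * H (j, η) ∂(muT n) with hc
  have hcs : ∀ k, Summable fun j => ‖c k (-j)‖ := by
    intro k
    have h1 : ∑' j, ‖c k j‖ₑ ≤ ∫⁻ p, ‖H p‖ₑ ∂(muZT n) := by
      rw [lintegral_muZT]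
      refine ENNReal.tsum_le_tsum fun j => (enorm_integral_le_lintegral_enorm _).trans_eq ?_
      simp [enorm_mul, enorm_character]
    have h2 := ENNReal.summable_toReal (h1.trans_lt hH.2).ne
    simp only [toReal_enorm] at h2
    exact (Equiv.neg (Zn n)).summable_iff.mpr h2
  have hV : ∀ ξ k, fourierZT H (ξ, k) = ∑' j, c k (-j) * character j ξ := by
    intro ξ k
    rw [fourierZT, ← (Equiv.neg (Zn n)).tsum_eq]
    refine tsum_congr fun j => ?_
    simp only [Equiv.neg_apply, neg_neg, hc, mul_assoc, integral_const_mul]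
    rw [mul_comm]
  rw [ae_muZT_iff]
  intro j
  filter_upwards [ae_enorm_le_tsum_enorm_coeff (integrable_slice hH j)] with η hη
  refine hη.trans ?_
  rw [lintegral_muTZ]
  refine ENNReal.tsum_le_tsum fun k => ?_
  -- Inversion in the lattice variable alone: `c k j` is a Fourier coefficient of the continuous
  -- function `ξ ↦ fourierZT H (ξ, k)`, hence at most its `L¹` norm. The sum over `k` inverts the
  -- torus variable.
  have h1 := integral_character_neg_mul_tsum (hcs k) (-j)
  rw [neg_neg] at h1
  simp only [← hV] at h1
  change ‖c k j‖ₑ ≤ _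
  rw [← h1]
  refine (enorm_integral_le_lintegral_enorm _).trans_eq ?_
  simp [enorm_mul, enorm_character]

/-! ### Schwartz windows on `ℤⁿ × 𝕋ⁿ` -/

lemma isOpenQuotientMap_coe_torus :
    IsOpenQuotientMap (fun (x : Fin n → ℝ) i => (x i : UnitAddCircle)) :=
  IsOpenQuotientMap.piMap fun _ => QuotientAddGroup.isOpenQuotientMap_mk

lemma IsSchwartzZT.continuous {γ : Zn n × Tn n → ℂ} (hγ : IsSchwartzZT γ) : Continuous γ := by
  rw [continuous_prod_of_discrete_left]
  intro j
  exact isOpenQuotientMap_coe_torus.isQuotientMap.continuous_iff.mpr (hγ.1 j).continuous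

lemma IsSchwartzZT.decay {γ : Zn n × Tn n → ℂ} (hγ : IsSchwartzZT γ) (N : ℕ) :
    ∃ C : ℝ, ∀ j η, (1 + ‖j‖) ^ N * ‖γ (j, η)‖ ≤ C := by
  obtain ⟨C, hC⟩ := hγ.2 N 0
  refine ⟨C, fun j η => ?_⟩
  obtain ⟨x, rfl⟩ := isOpenQuotientMap_coe_torus.surjective η
  have := hC j x
  rwa [norm_iteratedFDeriv_zero] at this

/-- A tempered function times a translate of a Schwartz function is integrable. -/
lemma integrable_mul_conj_translate {γ ς : Zn n × Tn n → ℂ} (hγ : IsSchwartzZT γ)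
    (hς : IsTemperedZT ς) (z : Zn n × Tn n) :
    Integrable (fun p => ς p * conj (γ (p - z))) (muZT n) := by
  obtain ⟨hm, C, N, hC⟩ := hς
  obtain ⟨D, hD⟩ := hγ.decay (N + 2 * n)
  refine ⟨hm.mul ?_, ?_⟩
  · have : Continuous fun p : Zn n × Tn n => conj (γ (p - z)) :=
      Complex.continuous_conj.comp (hγ.continuous.comp (continuous_id.sub continuous_const))
    exact this.aestronglyMeasurable
  set b : Zn n → ℝ := fun j => D * ((1 + ‖j‖) ^ (N + 2 * n))⁻¹ with hb
  have hD0 : 0 ≤ D := le_trans (by positivity) (hD 0 0)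
  have hb0 : ∀ j, 0 ≤ b j := fun j => by positivity
  have hγb : ∀ j η, ‖γ (j, η)‖ ≤ b j := fun j η => by
    rw [hb]
    simp only
    rw [← div_eq_mul_inv, le_div_iff₀ (by positivity), mul_comm]
    exact hD j η
  have hs : Summable fun j => |C| * (1 + ‖j‖) ^ N * b (j - z.1) := by
    refine summable_mul_of_decay (C := |C|) (D := D) (fun _ => by positivity) hb0
      (fun _ => le_rfl) (fun k => ?_) z.1
    rw [hb]
    simp only
    rw [mul_left_comm, mul_inv_cancel₀ (by positivity), mul_one]
  rw [HasFiniteIntegral, lintegral_muZT]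
  refine lt_of_le_of_lt (ENNReal.tsum_le_tsum fun j => ?_) hs.tsum_ofReal_lt_top
  calc ∫⁻ η, ‖ς (j, η) * conj (γ ((j, η) - z))‖ₑ ∂(muT n)
      ≤ ∫⁻ η, ‖ς (j, η)‖ₑ * ENNReal.ofReal (b (j - z.1)) ∂(muT n) := by
        refine lintegral_mono fun η => ?_
        rw [enorm_mul]
        gcongr
        rw [← ofReal_norm, RCLike.norm_conj]
        exact ENNReal.ofReal_le_ofReal (hγb _ _)
    _ = (∫⁻ η, ‖ς (j, η)‖ₑ ∂(muT n)) * ENNReal.ofReal (b (j - z.1)) :=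
        lintegral_mul_const' _ _ ENNReal.ofReal_ne_top
    _ ≤ ENNReal.ofReal (|C| * (1 + ‖j‖) ^ N) * ENNReal.ofReal (b (j - z.1)) := by
        gcongr
        refine (hC j).trans (ENNReal.ofReal_le_ofReal ?_)
        gcongr
        exact le_abs_self C
    _ = _ := (ENNReal.ofReal_mul (by positivity)).symm

lemma stftZT_eq_fourierZT (γ F : Zn n × Tn n → ℂ) (z : Zn n × Tn n) (q : Tn n × Zn n) :
    stftZT γ F (z, q) = fourierZT (fun p => F p * conj (γ (p - z))) q := by
  simp only [stftZT, fourierZT, mul_assoc]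
  rfl

/-! ### The embedding of `M¹` in `L¹` -/

lemma iSup_enorm_mul_lintegral_le_m1Norm {γ ς : Zn n × Tn n → ℂ} (hγ : IsSchwartzZT γ)
    (hς : MemM1 γ ς) :
    (⨆ p, ‖γ p‖ₑ) * ∫⁻ p, ‖ς p‖ₑ ∂(muZT n) ≤ m1Norm γ ς := by
  set μ := muZT n with hμ
  set h : Zn n × Tn n → ℝ≥0∞ := fun z => ∫⁻ q, ‖stftZT γ ς (z, q)‖ₑ ∂(muTZ n) with hh
  have hM : m1Norm γ ς = ∫⁻ z, h z ∂μ := by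
    rw [m1Norm, eLpNorm_one_eq_lintegral_enorm, lintegral_prod _ hς.2.1.enorm]
  have hpt : ∀ z, ∀ᵐ p ∂μ, ‖ς p‖ₑ * ‖γ (p - z)‖ₑ ≤ h z := by
    intro z
    filter_upwards [ae_enorm_le_lintegral_fourierZT (integrable_mul_conj_translate hγ hς.1 z)]
      with p hp
    simp only [← stftZT_eq_fourierZT] at hp
    refine le_trans (le_of_eq ?_) hp
    rw [enorm_mul, ← ofReal_norm (conj _), RCLike.norm_conj, ofReal_norm]
  have hςm := hς.1.1
  -- Tonelli needs joint measurability of `|s(p)| a(p - z)`, so `ς` is replaced by a measurable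
  -- representative.
  set s := hςm.mk ς with hs
  have hsm : Measurable s := hςm.stronglyMeasurable_mk.measurable
  have hse : ς =ᵐ[μ] s := hςm.ae_eq_mk
  have hS : ∫⁻ p, ‖ς p‖ₑ ∂μ = ∫⁻ p, ‖s p‖ₑ ∂μ :=
    lintegral_congr_ae (hse.mono fun p hp => by simp [hp])
  rw [hS, hM]
  -- the key estimate, localized to a set of translations
  have key : ∀ A : Set (Zn n × Tn n), MeasurableSet A → μ A ≠ ∞ →
      (∫⁻ p, ‖s p‖ₑ ∂μ) * ∫⁻ y in A, ‖γ y‖ₑ ∂μ ≤ (∫⁻ z, h z ∂μ) * μ A := by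
    intro A hA hAtop
    set a : Zn n × Tn n → ℝ≥0∞ := A.indicator fun y => ‖γ y‖ₑ with ha
    have ham : Measurable a := hγ.continuous.measurable.enorm.indicator hA
    have hsub : Measurable fun q : (Zn n × Tn n) × (Zn n × Tn n) => ‖s q.1‖ₑ * a (q.1 - q.2) :=
      (hsm.comp measurable_fst).enorm.mul (ham.comp (measurable_fst.sub measurable_snd))
    calc (∫⁻ p, ‖s p‖ₑ ∂μ) * ∫⁻ y in A, ‖γ y‖ₑ ∂μ
        = ∫⁻ p, ∫⁻ z, ‖s p‖ₑ * a (p - z) ∂μ ∂μ := by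
          rw [← lintegral_mul_const _ hsm.enorm]
          refine lintegral_congr fun p => ?_
          have hm : Measurable fun z => a (p - z) := ham.comp (measurable_const.sub measurable_id)
          rw [lintegral_const_mul _ hm,
            lintegral_sub_left_eq_self (μ := μ) a p, ha, lintegral_indicator hA]
      _ = ∫⁻ z, ∫⁻ p, ‖s p‖ₑ * a (p - z) ∂μ ∂μ := lintegral_lintegral_swap hsub.aemeasurable
      _ ≤ ∫⁻ z, h z * μ A ∂μ := by
          refine lintegral_mono fun z => ?_
          calc ∫⁻ p, ‖s p‖ₑ * a (p - z) ∂μ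
              ≤ ∫⁻ p, h z * A.indicator 1 (p - z) ∂μ := by
                refine lintegral_mono_ae ?_
                filter_upwards [hpt z, hse] with p hp hps
                by_cases hpA : p - z ∈ A
                · simpa [ha, hpA, ← hps] using hp
                · simp [ha, hpA]
            _ = h z * μ A := by
                have hm : Measurable fun p => A.indicator (1 : Zn n × Tn n → ℝ≥0∞) (p - z) :=
                  (measurable_one.indicator hA).comp (measurable_id.sub measurable_const)
                rw [lintegral_const_mul _ hm,
                  lintegral_sub_right_eq_self (μ := μ) (A.indicator 1) z,
                  lintegral_indicator_one hA]
      _ = (∫⁻ z, h z ∂μ) * μ A := lintegral_mul_const' _ _ hAtop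
  rw [ENNReal.iSup_mul]
  -- It suffices to treat `c < |γ(p₀)|`. The set `A` below is open and nonempty, hence of positive
  -- measure, and it lies in a single slice, hence has finite measure; `μ A` then cancels from
  -- `key`.
  refine iSup_le fun p₀ => ENNReal.mul_le_of_forall_lt fun c hc b hb => ?_
  refine (mul_le_mul_right hb.le c).trans ?_
  set A : Set (Zn n × Tn n) := {p | p.1 = p₀.1 ∧ c < ‖γ p‖ₑ} with hAdef
  have hAopen : IsOpen A :=
    ((isOpen_discrete {p₀.1}).preimage continuous_fst).inter
      (isOpen_lt continuous_const hγ.continuous.enorm)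
  have hA0 : μ A ≠ 0 := (hAopen.measure_pos μ ⟨p₀, rfl, hc⟩).ne'
  have hAtop : μ A ≠ ∞ := by
    have : μ A ≤ μ ({p₀.1} ×ˢ Set.univ) := measure_mono fun p hp => ⟨hp.1, trivial⟩
    refine (this.trans_lt ?_).ne
    rw [hμ, muZT, Measure.prod_prod]
    simp
  have h1 := key A hAopen.measurableSet hAtop
  have h2 : c * μ A ≤ ∫⁻ y in A, ‖γ y‖ₑ ∂μ := by
    rw [← setLIntegral_const]
    exact setLIntegral_mono' hAopen.measurableSet fun p hp => hp.2.le
  rw [← ENNReal.mul_le_mul_iff_left hA0 hAtop]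
  calc c * (∫⁻ p, ‖s p‖ₑ ∂μ) * μ A = (∫⁻ p, ‖s p‖ₑ ∂μ) * (c * μ A) := by ring
    _ ≤ _ := (mul_le_mul_right h2 _).trans h1

/-! ### Time-frequency shifts on `ℓ²(ℤⁿ)` -/

lemma summable_norm_sq (f : ellTwo n) : Summable fun k => ‖f k‖ ^ 2 := by
  have := (lp.memℓp f).summable (by norm_num)
  simpa using this

lemma norm_sq_eq_tsum (f : ellTwo n) : ‖f‖ ^ 2 = ∑' k, ‖f k‖ ^ 2 := by
  have := lp.norm_rpow_eq_tsum (p := 2) (by norm_num) f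
  simpa using this

lemma tsum_enorm_sq (f : ellTwo n) : ∑' k, ‖f k‖ₑ ^ 2 = ‖f‖ₑ ^ 2 := by
  rw [← ofReal_norm, ← ENNReal.ofReal_pow (norm_nonneg _), norm_sq_eq_tsum,
    ENNReal.ofReal_tsum_of_nonneg (fun _ => by positivity) (summable_norm_sq f)]
  simp only [ENNReal.ofReal_pow (norm_nonneg _), ofReal_norm]

lemma memℓp_two_of_summable {f : Zn n → ℂ} (hf : Summable fun k => ‖f k‖ ^ 2) :
    Memℓp (E := fun _ : Zn n => ℂ) f 2 :=
  memℓp_gen (by simpa using hf)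

lemma memℓp_two_of_tsum_ne_top {f : Zn n → ℂ} (hf : ∑' k, ‖f k‖ₑ ^ 2 ≠ ∞) :
    Memℓp (E := fun _ : Zn n => ℂ) f 2 :=
  memℓp_two_of_summable (by simpa using ENNReal.summable_toReal hf)

/-- The time-frequency shift `M_w T_m g`. -/
noncomputable def tfShift (g : ellTwo n) (z : Zn n × Tn n) : ellTwo n :=
  ⟨fun k => character k z.2 * g (k - z.1), memℓp_two_of_summable (by
    simp only [norm_mul, norm_character, one_mul]
    exact (Equiv.subRight z.1).summable_iff.mpr (summable_norm_sq g))⟩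

lemma tfShift_apply (g : ellTwo n) (z : Zn n × Tn n) (k : Zn n) :
    tfShift g z k = character k z.2 * g (k - z.1) := rfl

lemma norm_tfShift (g : ellTwo n) (z : Zn n × Tn n) : ‖tfShift g z‖ = ‖g‖ := by
  rw [← sq_eq_sq₀ (norm_nonneg _) (norm_nonneg _), norm_sq_eq_tsum, norm_sq_eq_tsum]
  simp only [tfShift_apply, norm_mul, norm_character, one_mul]
  exact (Equiv.subRight z.1).tsum_eq fun k => ‖g k‖ ^ 2

lemma inner_tfShift (g f : ellTwo n) (z : Zn n × Tn n) :
    inner ℂ (tfShift g z) f = stft g f z := by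
  rw [lp.inner_eq_tsum, stft]
  refine tsum_congr fun k => ?_
  rw [RCLike.inner_apply, tfShift_apply, map_mul, character_neg]
  ring

lemma summable_mul_conj_translate (f g : ellTwo n) (m : Zn n) :
    Summable fun k => f k * conj (g (k - m)) := by
  refine (lp.summable_inner (𝕜 := ℂ) (tfShift g (m, 0)) f).congr fun k => ?_
  rw [RCLike.inner_apply, tfShift_apply]
  have : character k (0 : Tn n) = 1 := by
    simp [character, UnitAddTorus.mFourier]
  simp [this]

/-- Dominated convergence for the series of `|·|²`. Continuity makes the rank-one integrand
measurable in operator norm. -/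
lemma continuous_tfShift (g : ellTwo n) : Continuous (tfShift g) := by
  rw [continuous_prod_of_discrete_left]
  intro m
  rw [continuous_iff_continuousAt]
  intro w₀
  rw [ContinuousAt, tendsto_iff_norm_sub_tendsto_zero]
  have h1 : Tendsto (fun w : Tn n => ‖tfShift g (m, w) - tfShift g (m, w₀)‖ ^ 2) (𝓝 w₀) (𝓝 0) := by
    simp only [norm_sq_eq_tsum]
    have hs : Summable fun k => 4 * ‖g (k - m)‖ ^ 2 :=
      ((Equiv.subRight m).summable_iff.mpr (summable_norm_sq g)).mul_left 4
    have h2 := tendsto_tsum_of_dominated_convergence (𝓕 := 𝓝 w₀)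
      (f := fun (w : Tn n) k => ‖(tfShift g (m, w) - tfShift g (m, w₀) : ellTwo n) k‖ ^ 2)
      (g := fun _ => (0 : ℝ)) hs (fun k => ?_) (Eventually.of_forall fun w k => ?_)
    · simpa using h2
    · have : Continuous fun w : Tn n => ‖(tfShift g (m, w) - tfShift g (m, w₀) : ellTwo n) k‖ ^ 2 := by
        simp only [lp.coeFn_sub, Pi.sub_apply, tfShift_apply]
        have := continuous_character k
        fun_prop
      have := this.tendsto w₀
      simpa using this
    · simp only [lp.coeFn_sub, Pi.sub_apply, tfShift_apply, ← sub_mul, norm_mul, norm_pow, norm_norm,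
        mul_pow]
      gcongr
      calc ‖character k w - character k w₀‖ ^ 2 ≤ (1 + 1) ^ 2 := by
            gcongr
            exact (norm_sub_le _ _).trans_eq (by rw [norm_character, norm_character])
        _ = 4 := by norm_num
  have h3 := (Real.continuous_sqrt.tendsto 0).comp h1
  simpa [Function.comp_def, Real.sqrt_sq] using h3

/-! ### Lower bounds for the Young function -/

section Young

/-- Four digits matter: the inequality `1 < A` in `three_mul_enorm_sq_le_mPhiNorm` holds with a
margin of only about `0.003`. -/
lemma exp_neg_three_halves_bounds :
    (0.2231 : ℝ) < Real.exp (-(3 / 2)) ∧ Real.exp (-(3 / 2)) < 0.2232 := by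
  have h : Real.exp (-(3 / 2)) ^ 2 * Real.exp 1 ^ 3 = 1 := by
    rw [← Real.exp_nat_mul, ← Real.exp_nat_mul, ← Real.exp_add]
    norm_num
  have h0 := Real.exp_pos (-(3 / 2) : ℝ)
  have h1 := Real.exp_one_gt_d9
  have h2 := Real.exp_one_lt_d9
  have h3 : (2.7182818283 : ℝ) ^ 3 < Real.exp 1 ^ 3 := pow_lt_pow_left₀ h1 (by norm_num) (by norm_num)
  have h4 : Real.exp 1 ^ 3 < (2.7182818286 : ℝ) ^ 3 := pow_lt_pow_left₀ h2 (by positivity) (by norm_num)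
  constructor
  · by_contra! hle
    have : Real.exp (-(3 / 2)) ^ 2 ≤ (0.2231 : ℝ) ^ 2 := pow_le_pow_left₀ h0.le hle 2
    nlinarith
  · by_contra! hle
    have : (0.2232 : ℝ) ^ 2 ≤ Real.exp (-(3 / 2)) ^ 2 := pow_le_pow_left₀ (by norm_num) hle 2
    nlinarith

variable {Φ : ℝ≥0∞ → ℝ≥0∞}

lemma sq_le_young_of_le (hΦ₀ : EntropyNearZero Φ) {x : ℝ} (hx0 : 0 ≤ x)
    (hx : x ≤ Real.exp (-(3 / 2))) : ENNReal.ofReal (1.5 * x ^ 2) ≤ Φ (ENNReal.ofReal x) := by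
  rw [hΦ₀ x hx0 hx]
  refine ENNReal.ofReal_le_ofReal ?_
  rcases hx0.eq_or_lt with rfl | hpos
  · simp
  have : Real.log x ≤ -(3 / 2) := (Real.log_le_iff_le_exp hpos).mpr hx
  nlinarith [sq_nonneg x, mul_le_mul_of_nonneg_left this (sq_nonneg x)]

/-- The affine minorant given by the secant through `0.99 e^{-3/2}` and `e^{-3/2}`. -/
lemma affine_le_young (hΦ : IsYoung Φ) (hΦ₀ : EntropyNearZero Φ) {x : ℝ}
    (hx : Real.exp (-(3 / 2)) ≤ x) :
    ENNReal.ofReal (Real.exp (-(3 / 2)) * (1.995 * x - 0.495 * Real.exp (-(3 / 2))))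
      ≤ Φ (ENNReal.ofReal x) := by
  set a := Real.exp (-(3 / 2)) with ha
  have ha0 : 0 < a := Real.exp_pos _
  by_cases htop : Φ (ENNReal.ofReal x) = ∞
  · simp [htop]
  obtain ⟨y, hy⟩ : ∃ y : ℝ≥0, (y : ℝ≥0∞) = Φ (ENNReal.ofReal x) := ⟨_, ENNReal.coe_toNNReal htop⟩
  rw [← hy, ← ENNReal.ofReal_coe_nnreal]
  refine ENNReal.ofReal_le_ofReal ?_
  set t := 0.99 * a with ht
  have ht0 : 0 < t := by positivity
  have hxt : 0 < x - t := by linarith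
  -- `a` is written as the convex combination `l t + r x`; convexity bounds `Φ(a)` by `l Φ(t) + r
  -- Φ(x)`, which is then solved for `Φ(x)`.
  set l : ℝ := (x - a) / (x - t) with hl
  set r : ℝ := (a - t) / (x - t) with hr
  have hl0 : 0 ≤ l := div_nonneg (by linarith) hxt.le
  have hr0 : 0 ≤ r := div_nonneg (by linarith) hxt.le
  have hlr : l + r = 1 := by rw [hl, hr, ← add_div, div_eq_one_iff_eq hxt.ne']; ring
  have hmix : l * t + r * x = a := by
    rw [hl, hr]; field_simp; ring
  have hconv := hΦ.convex l.toNNReal r.toNNReal t.toNNReal x.toNNReal (by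
    rw [← Real.toNNReal_add hl0 hr0, hlr, Real.toNNReal_one])
  simp only [← ENNReal.ofReal.eq_1] at hconv
  have hx0 : 0 ≤ x := by linarith
  rw [← ENNReal.ofReal_mul hl0, ← ENNReal.ofReal_mul hr0,
    ← ENNReal.ofReal_add (by positivity) (by positivity), hmix, hΦ₀ a ha0.le le_rfl,
    hΦ₀ t ht0.le (by linarith), ← hy, ← ENNReal.ofReal_coe_nnreal, ← ENNReal.ofReal_mul hl0,
    ← ENNReal.ofReal_mul hr0, ha, Real.log_exp, ← ha] at hconv
  have hlogt : Real.log t = Real.log 0.99 + -(3 / 2) := by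
    rw [ht, Real.log_mul (by norm_num) ha0.ne', ha, Real.log_exp]
  have hlog99 : -(1 / 99) ≤ Real.log 0.99 := by
    have := Real.one_sub_inv_le_log_of_pos (x := 0.99) (by norm_num)
    norm_num at this ⊢
    linarith
  have hlog0 : Real.log 0.99 ≤ 0 := Real.log_nonpos (by norm_num) (by norm_num)
  -- `0.99² (3/2 + 1/99) = 1.48005`, so the secant slope is at least `(1.5 - 1.48005) a / 0.01 =
  -- 1.995 a`, close to the tangent slope `2a`.
  have hφt : -(t ^ 2 * Real.log t) ≤ 1.48005 * a ^ 2 := by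
    rw [hlogt, ht]
    nlinarith [mul_le_mul_of_nonneg_left hlog99 (sq_nonneg a)]
  have hφt0 : 0 ≤ -(t ^ 2 * Real.log t) := by
    rw [hlogt]; nlinarith [mul_nonneg (sq_nonneg t) (neg_nonneg.mpr hlog0), sq_nonneg t]
  rw [← ENNReal.ofReal_add (by positivity) (by positivity),
    ENNReal.ofReal_le_ofReal_iff (by positivity)] at hconv
  have h1 : (x - t) * (1.5 * a ^ 2) ≤ (x - a) * (1.48005 * a ^ 2) + (a - t) * y := by
    have h2 : 1.5 * a ^ 2 ≤ l * (1.48005 * a ^ 2) + r * y := by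
      have := mul_le_mul_of_nonneg_left hφt hl0
      linarith
    have h3 := mul_le_mul_of_nonneg_left h2 hxt.le
    rwa [mul_add, ← mul_assoc (x - t) l, ← mul_assoc (x - t) r, hl, hr, mul_div_cancel₀ _ hxt.ne',
      mul_div_cancel₀ _ hxt.ne'] at h3
  rw [ht] at h1
  have h4 : 0 ≤ (0.01 * a) * (y - a * (1.995 * x - 0.495 * a)) := by nlinarith
  have h5 := nonneg_of_mul_nonneg_right h4 (by positivity)
  linarith

/-- A quadratic minorant of `Φ` on `[0, M]`. -/
lemma mul_sq_le_young (hΦ : IsYoung Φ) (hΦ₀ : EntropyNearZero Φ) {D M x : ℝ} (hD0 : 0 ≤ D)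
    (hD : D ≤ 1.5)
    (hDM : D * M ^ 2 ≤ Real.exp (-(3 / 2)) * (1.995 * M - 0.495 * Real.exp (-(3 / 2))))
    (hx0 : 0 ≤ x) (hx : x ≤ M) :
    ENNReal.ofReal (D * x ^ 2) ≤ Φ (ENNReal.ofReal x) := by
  rcases le_total x (Real.exp (-(3 / 2))) with hxa | hxa
  · exact (ENNReal.ofReal_le_ofReal (by nlinarith [sq_nonneg x])).trans (sq_le_young_of_le hΦ₀ hx0 hxa)
  refine (ENNReal.ofReal_le_ofReal ?_).trans (affine_le_young hΦ hΦ₀ hxa)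
  set a := Real.exp (-(3 / 2)) with ha
  have ha0 : 0 < a := Real.exp_pos _
  rcases hxa.eq_or_lt with hxa' | hxa'
  · rw [← hxa']; nlinarith [sq_nonneg a]
  have hMa : 0 < M - a := by linarith
  -- On `[a, M]` the parabola lies below its chord, and the affine minorant dominates that chord at
  -- both ends: at `a` by `hD`, at `M` by `hDM`.
  have h1 : D * x ^ 2 ≤ D * ((a + M) * x - a * M) := by
    refine mul_le_mul_of_nonneg_left ?_ hD0
    nlinarith [mul_nonneg (sub_nonneg.mpr hxa) (sub_nonneg.mpr hx)]
  refine h1.trans (sub_nonneg.mp (nonneg_of_mul_nonneg_right ?_ hMa))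
  have h2 : D * a ^ 2 ≤ 1.5 * a ^ 2 := mul_le_mul_of_nonneg_right hD (sq_nonneg a)
  nlinarith [mul_nonneg (sub_nonneg.mpr hx) (sub_nonneg.mpr h2),
    mul_nonneg (sub_nonneg.mpr hxa) (sub_nonneg.mpr hDM)]

/-- Linear growth of `Φ`: on a probability space it turns a Luxemburg bound into an `L¹` bound. -/
lemma le_add_young (hΦ : IsYoung Φ) (hΦ₀ : EntropyNearZero Φ) {x : ℝ} (hx0 : 0 ≤ x) :
    ENNReal.ofReal x ≤ 1 + 3 * Φ (ENNReal.ofReal x) := by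
  have hb := exp_neg_three_halves_bounds
  rcases le_total x (Real.exp (-(3 / 2))) with hxa | hxa
  · exact le_add_right (ENNReal.ofReal_le_one.mpr (by linarith))
  refine le_trans ?_ (add_le_add_right (mul_le_mul_right (affine_le_young hΦ hΦ₀ hxa) 3) 1)
  have h3 : (3 : ℝ≥0∞) = ENNReal.ofReal 3 := by simp
  rw [h3, ← ENNReal.ofReal_mul (by norm_num), ← ENNReal.ofReal_one,
    ← ENNReal.ofReal_add (by norm_num) (by nlinarith)]
  exact ENNReal.ofReal_le_ofReal (by nlinarith)

end Young

/-! ### The short-time Fourier transform as a Fourier series -/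

lemma stft_eq_tsum_character (g f : Zn n → ℂ) (m : Zn n) (w : Tn n) :
    stft g f (m, w) = ∑' k, (f (-k) * conj (g (-k - m))) * character k w := by
  rw [stft, ← (Equiv.neg (Zn n)).tsum_eq]
  simp

section STFT

variable {g f : Zn n → ℂ} (h : ∀ m, Summable fun k => ‖f k * conj (g (k - m))‖)
include h

lemma summable_stft_coeff (m : Zn n) : Summable fun k => ‖f (-k) * conj (g (-k - m))‖ :=
  (Equiv.neg (Zn n)).summable_iff.mpr (h m)

/-- Orthogonality relation: Parseval in `w` for each `m`, then the sum over `m`. Both sides may be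
infinite, which is what allows `g ∈ ℓ²` to be deduced from it. -/
lemma lintegral_enorm_stft_sq :
    ∫⁻ p, ‖stft g f p‖ₑ ^ 2 ∂(muZT n) = (∑' k, ‖f k‖ₑ ^ 2) * ∑' k, ‖g k‖ₑ ^ 2 := by
  rw [lintegral_muZT]
  have h1 : ∀ m, ∫⁻ w, ‖stft g f (m, w)‖ₑ ^ 2 ∂(muT n) = ∑' k, ‖f k‖ₑ ^ 2 * ‖g (k - m)‖ₑ ^ 2 := by
    intro m
    simp only [stft_eq_tsum_character]
    rw [lintegral_tsum_mul_character_sq (summable_stft_coeff h m),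
      ← (Equiv.neg (Zn n)).tsum_eq (fun k => ‖f k‖ₑ ^ 2 * ‖g (k - m)‖ₑ ^ 2)]
    refine tsum_congr fun k => ?_
    rw [enorm_mul, mul_pow, ← ofReal_norm (conj _), RCLike.norm_conj, ofReal_norm]
    rfl
  simp only [h1]
  rw [ENNReal.tsum_comm, ← ENNReal.tsum_mul_right]
  refine tsum_congr fun k => ?_
  rw [ENNReal.tsum_mul_left]
  exact congrArg _ ((Equiv.subLeft k).tsum_eq fun l => ‖g l‖ₑ ^ 2)

lemma enorm_coeff_le_lintegral_stft (m k : Zn n) :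
    ‖f k * conj (g (k - m))‖ₑ ≤ ∫⁻ w, ‖stft g f (m, w)‖ₑ ∂(muT n) := by
  have h1 := integral_character_neg_mul_tsum (summable_stft_coeff h m) (-k)
  simp only [← stft_eq_tsum_character, neg_neg] at h1
  rw [← h1]
  refine (enorm_integral_le_lintegral_enorm _).trans_eq ?_
  simp [enorm_mul, enorm_character]

lemma norm_stft_le (p : Zn n × Tn n) : ‖stft g f p‖ ≤ ∑' k, ‖f k * conj (g (k - p.1))‖ := by
  rw [← (Equiv.neg (Zn n)).tsum_eq fun k => ‖f k * conj (g (k - p.1))‖, ← Prod.mk.eta (p := p),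
    stft_eq_tsum_character]
  exact norm_tsum_mul_character_le (summable_stft_coeff h p.1) p.2

end STFT

lemma summable_stft_of_tempered {g₀ g : Zn n → ℂ} (hg₀ : IsSchwartzZ g₀) (hg : IsTemperedZ g)
    (m : Zn n) : Summable fun k => ‖g k * conj (g₀ (k - m))‖ := by
  obtain ⟨C, N, hC⟩ := hg
  obtain ⟨D, hD⟩ := hg₀ (N + 2 * n)
  simp only [norm_mul, RCLike.norm_conj]
  exact summable_mul_of_decay (fun _ => norm_nonneg _) (fun _ => norm_nonneg _) hC hD m

lemma IsSchwartzZ.summable_norm {g₀ : Zn n → ℂ} (hg₀ : IsSchwartzZ g₀) :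
    Summable fun k => ‖g₀ k‖ := by
  obtain ⟨D, hD⟩ := hg₀ (0 + 2 * n)
  have := summable_mul_of_decay (a := fun _ => (1 : ℝ)) (C := 1) (N := 0) (fun _ => zero_le_one)
    (fun k => norm_nonneg (g₀ k)) (fun _ => by simp) hD 0
  simpa using this

lemma IsSchwartzZ.memℓp {g₀ : Zn n → ℂ} (hg₀ : IsSchwartzZ g₀) :
    Memℓp (E := fun _ : Zn n => ℂ) g₀ 2 := by
  obtain ⟨D, hD⟩ := hg₀ 0
  refine memℓp_two_of_summable (Summable.of_nonneg_of_le (fun _ => by positivity) (fun k => ?_)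
    (hg₀.summable_norm.mul_left D))
  rw [sq]
  exact mul_le_mul_of_nonneg_right (by simpa using hD k) (norm_nonneg _)

/-! ### The embedding of `M^Φ` in `ℓ²` -/

section Embedding

variable {Φ : ℝ≥0∞ → ℝ≥0∞}

lemma enorm_div_eq_ofReal (x : ℂ) {b : ℝ≥0} (hb : 0 < b) : ‖x‖ₑ / b = ENNReal.ofReal (‖x‖ / b) := by
  rw [ENNReal.ofReal_div_of_pos (NNReal.coe_pos.mpr hb), ofReal_norm, ENNReal.ofReal_coe_nnreal]

/-- If `|F| ≤ M b` then `∫ |F|²` is controlled by `∫ Φ(|F| / b)`. -/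
lemma lintegral_sq_le_of_young (hΦ : IsYoung Φ) (hΦ₀ : EntropyNearZero Φ) {X : Type*}
    [MeasurableSpace X] {μ : Measure X} {F : X → ℂ} {b : ℝ≥0} (hb : 0 < b)
    (hF : ∫⁻ x, Φ (‖F x‖ₑ / b) ∂μ ≤ 1) {D M : ℝ} (hD0 : 0 ≤ D) (hD : D ≤ 1.5)
    (hDM : D * M ^ 2 ≤ Real.exp (-(3 / 2)) * (1.995 * M - 0.495 * Real.exp (-(3 / 2))))
    (hM : ∀ x, ‖F x‖ ≤ M * b) :
    ENNReal.ofReal (D / b ^ 2) * ∫⁻ x, ‖F x‖ₑ ^ 2 ∂μ ≤ 1 := by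
  rw [← lintegral_const_mul' _ _ ENNReal.ofReal_ne_top]
  refine (lintegral_mono fun x => ?_).trans hF
  have hb' : (0 : ℝ) < b := NNReal.coe_pos.mpr hb
  rw [enorm_div_eq_ofReal _ hb]
  refine le_trans (le_of_eq ?_) (mul_sq_le_young hΦ hΦ₀ hD0 hD hDM (by positivity)
    ((div_le_iff₀ hb').mpr (hM x)))
  rw [← ofReal_norm, ← ENNReal.ofReal_pow (norm_nonneg _), ← ENNReal.ofReal_mul (by positivity)]
  congr 1
  ring

/-- Since `g` is only tempered, Cauchy–Schwarz cannot bound the transform yet. Its slices are first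
bounded in `L¹`, whence `g`, read off from Fourier coefficients, is bounded; then so is the
transform, and a quadratic minorant applies. -/
lemma MemMPhi.memℓp (hΦ : IsYoung Φ) (hΦ₀ : EntropyNearZero Φ) {g₀ g : Zn n → ℂ}
    (hg₀ : IsSchwartzZ g₀) (hg₀' : g₀ ≠ 0) (hg : MemMPhi Φ g₀ g) :
    Memℓp (E := fun _ : Zn n => ℂ) g 2 := by
  have hs := summable_stft_of_tempered hg₀ hg.1
  obtain ⟨b, ⟨hb, hF⟩, -⟩ : ∃ b : ℝ≥0, (0 < b ∧ ∫⁻ x, Φ (‖stft g₀ g x‖ₑ / b) ∂(muZT n) ≤ 1) ∧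
      (b : ℝ≥0∞) < ∞ := by
    have := hg.2
    rw [mPhiNorm, orliczNorm] at this
    simpa only [iInf_lt_iff, exists_prop] using this
  have hb' : (0 : ℝ) < b := NNReal.coe_pos.mpr hb
  -- the slices of the transform are uniformly bounded in `L¹`
  have hL1 : ∀ m, ∫⁻ w, ‖stft g₀ g (m, w)‖ₑ ∂(muT n) ≤ 4 * b := by
    intro m
    have h1 : ∀ w, ‖stft g₀ g (m, w)‖ₑ ≤ (1 + 3 * Φ (‖stft g₀ g (m, w)‖ₑ / b)) * b := by
      intro w
      have := le_add_young hΦ hΦ₀ (x := ‖stft g₀ g (m, w)‖ / b) (by positivity)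
      rw [← enorm_div_eq_ofReal _ hb] at this
      exact (ENNReal.div_le_iff (by exact_mod_cast hb.ne') ENNReal.coe_ne_top).mp this
    calc ∫⁻ w, ‖stft g₀ g (m, w)‖ₑ ∂(muT n)
        ≤ ∫⁻ w, (1 + 3 * Φ (‖stft g₀ g (m, w)‖ₑ / b)) * b ∂(muT n) := lintegral_mono h1
      _ = (1 + 3 * ∫⁻ w, Φ (‖stft g₀ g (m, w)‖ₑ / b) ∂(muT n)) * b := by
          rw [lintegral_mul_const' _ _ ENNReal.coe_ne_top, lintegral_add_left measurable_const,
            lintegral_const_mul' _ _ (by simp)]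
          simp
      _ ≤ (1 + 3 * 1) * b := by
          gcongr
          rw [lintegral_muZT] at hF
          exact (ENNReal.le_tsum m).trans hF
      _ = 4 * b := by norm_num
  obtain ⟨l, hl⟩ := Function.ne_iff.mp hg₀'
  have hl0 : 0 < ‖g₀ l‖ := norm_pos_iff.mpr hl
  have hgb : ∀ k, ‖g k‖ ≤ 4 * b / ‖g₀ l‖ := by
    intro k
    -- Translating by `k - l` pairs `g k` with the fixed non-zero value `g₀ l`.
    have h1 := (enorm_coeff_le_lintegral_stft hs (k - l) k).trans (hL1 (k - l))
    rw [sub_sub_cancel, ← ofReal_norm, norm_mul, RCLike.norm_conj,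
      show (4 : ℝ≥0∞) * b = ENNReal.ofReal (4 * b) by
        rw [ENNReal.ofReal_mul (by norm_num), ENNReal.ofReal_coe_nnreal]; simp,
      ENNReal.ofReal_le_ofReal_iff (by positivity)] at h1
    rwa [le_div_iff₀ hl0]
  set B := 4 * b / ‖g₀ l‖ * ∑' k, ‖g₀ k‖ with hB
  have hFB : ∀ p, ‖stft g₀ g p‖ ≤ B := by
    intro p
    refine (norm_stft_le hs p).trans ?_
    have hs' : Summable fun k => 4 * b / ‖g₀ l‖ * ‖g₀ (k - p.1)‖ :=
      ((Equiv.subRight p.1).summable_iff.mpr hg₀.summable_norm).mul_left _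
    calc ∑' k, ‖g k * conj (g₀ (k - p.1))‖ ≤ ∑' k, 4 * b / ‖g₀ l‖ * ‖g₀ (k - p.1)‖ := by
          refine (hs p.1).tsum_le_tsum (fun k => ?_) hs'
          rw [norm_mul, RCLike.norm_conj]
          exact mul_le_mul_of_nonneg_right (hgb k) (norm_nonneg _)
      _ = B := by
          rw [tsum_mul_left]
          exact congrArg _ ((Equiv.subRight p.1).tsum_eq fun k => ‖g₀ k‖)
  set M := max 1 (B / b) with hM
  have hM1 : 1 ≤ M := le_max_left _ _
  have ha := exp_neg_three_halves_bounds
  -- The affine minorant grows only linearly, so `D` must decay like `1 / M`.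
  set D := 0.1 / M with hDdef
  have hD0 : 0 < D := by positivity
  have h1 := lintegral_sq_le_of_young hΦ hΦ₀ hb hF (D := D) (M := M) hD0.le
    (by rw [hDdef, div_le_iff₀ (by positivity)]; nlinarith)
    (by
      have : D * M ^ 2 = 0.1 * M := by rw [hDdef]; field_simp
      rw [this]
      nlinarith)
    (fun p => (hFB p).trans ((div_le_iff₀ hb').mp (le_max_right _ _)))
  rw [lintegral_enorm_stft_sq hs] at h1
  refine memℓp_two_of_tsum_ne_top fun htop => ?_
  rw [htop, ENNReal.top_mul, ENNReal.mul_top] at h1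
  · simp at h1
  · simpa using (by positivity : 0 < D / b ^ 2)
  · rw [Ne, ENNReal.tsum_eq_zero]
    intro h0
    exact hl (by simpa using h0 l)

lemma three_mul_enorm_sq_le_mPhiNorm (hΦ : IsYoung Φ) (hΦ₀ : EntropyNearZero Φ) (g₀ g : ellTwo n) :
    3 * (‖g₀‖ₑ ^ 2 * ‖g‖ₑ ^ 2) ≤ 16 * mPhiNorm Φ g₀ g ^ 2 := by
  set P : ℝ := ‖g₀‖ * ‖g‖ with hP
  have hP0 : 0 ≤ P := by positivity
  set r : ℝ := √3 / 4 * P with hr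
  have hr2 : 16 * r ^ 2 = 3 * P ^ 2 := by
    rw [hr, mul_pow, div_pow, Real.sq_sqrt (by norm_num)]; ring
  have hle : ENNReal.ofReal r ≤ mPhiNorm Φ g₀ g := by
    refine le_iInf₂ fun b hb => ?_
    obtain ⟨hb, hF⟩ := hb
    rw [← ENNReal.ofReal_coe_nnreal]
    refine ENNReal.ofReal_le_ofReal ?_
    by_contra! hbr
    have hb' : (0 : ℝ) < b := NNReal.coe_pos.mpr hb
    have ha := exp_neg_three_halves_bounds
    set N := P / b with hN
    have hNb : N * b = P := div_mul_cancel₀ _ hb'.ne'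
    have hN0 : 0 ≤ N := by positivity
    have hN2 : 16 < 3 * N ^ 2 := by
      have h1 : (b : ℝ) ^ 2 < r ^ 2 := pow_lt_pow_left₀ hbr hb'.le two_ne_zero
      have h2 : 3 * N ^ 2 * b ^ 2 = 16 * r ^ 2 := by rw [hr2, ← hNb]; ring
      nlinarith [sq_nonneg (b : ℝ), pow_pos hb' 2]
    -- `b < r` means `N > 4/√3`. Since Cauchy–Schwarz gives `|V| ≤ N b`, the quadratic minorant on
    -- `[0, N]` yields `D N² ≤ 1`, whereas `1.5 N²` and `A` both exceed `1`.
    have hN1 : 2.3094 < N := by nlinarith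
    set a := Real.exp (-(3 / 2)) with ha'
    set A := a * (1.995 * N - 0.495 * a) with hA
    have hA1 : 1 < A := by nlinarith
    set D := min 1.5 (A / N ^ 2) with hD
    have hD0 : 0 ≤ D := by positivity
    have hN2' : 0 < N ^ 2 := by positivity
    have hDN : D * N ^ 2 ≤ A := (le_div_iff₀ hN2').mp (min_le_right _ _)
    have h1 := lintegral_sq_le_of_young hΦ hΦ₀ hb hF hD0 (min_le_left _ _) hDN (fun p => by
      rw [← inner_tfShift, hNb, hP]
      exact (norm_inner_le_norm _ _).trans_eq (by rw [norm_tfShift]))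
    rw [lintegral_enorm_stft_sq (fun m => (summable_mul_conj_translate g g₀ m).norm), tsum_enorm_sq,
      tsum_enorm_sq, ← ofReal_norm, ← ofReal_norm, ← ENNReal.ofReal_pow (norm_nonneg _),
      ← ENNReal.ofReal_pow (norm_nonneg _), ← ENNReal.ofReal_mul (by positivity),
      ← ENNReal.ofReal_mul (by positivity), ENNReal.ofReal_le_one] at h1
    have h2 : D / b ^ 2 * (‖g‖ ^ 2 * ‖g₀‖ ^ 2) = D * N ^ 2 := by
      rw [hN, hP]; field_simp
    rw [h2] at h1
    have h3 : 1 < D * N ^ 2 := by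
      rcases min_cases (1.5 : ℝ) (A / N ^ 2) with h | h
      · rw [hD, h.1]; nlinarith
      · rw [hD, h.1, div_mul_cancel₀ _ hN2'.ne']; exact hA1
    linarith
  calc 3 * (‖g₀‖ₑ ^ 2 * ‖g‖ₑ ^ 2) = 16 * ENNReal.ofReal r ^ 2 := by
        rw [← ENNReal.ofReal_pow (by positivity), ← mul_pow, ← enorm_norm g₀, ← enorm_norm g,
          ← enorm_mul, Real.enorm_eq_ofReal hP0, ← ENNReal.ofReal_pow hP0,
          show (3 : ℝ≥0∞) = ENNReal.ofReal 3 by simp, show (16 : ℝ≥0∞) = ENNReal.ofReal 16 by simp,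
          ← ENNReal.ofReal_mul (by norm_num), ← ENNReal.ofReal_mul (by norm_num), hr2]
    _ ≤ _ := by gcongr

end Embedding

/-! ### Trace class bounds for integrals of rank-one operators -/

/-- A closed subspace is itself a Banach space: integrate there and apply the inclusion. -/
lemma integral_mem_of_isClosed {E X : Type*} [NormedAddCommGroup E] [NormedSpace ℂ E]
    [CompleteSpace E] [MeasurableSpace X] {μ : Measure X} {K : Submodule ℂ E}
    (hK : IsClosed (K : Set E)) {f : X → E} (hf : Integrable f μ) (hfK : ∀ x, f x ∈ K) :
    ∫ x, f x ∂μ ∈ K := by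
  have : CompleteSpace K := hK.completeSpace_coe
  let F : X → K := fun x => ⟨f x, hfK x⟩
  have hF : Integrable F μ := by
    refine ⟨?_, ?_⟩
    · exact Topology.IsEmbedding.subtypeVal.aestronglyMeasurable_comp_iff.mp hf.1
    · exact hf.2
  have := K.subtypeL.integral_comp_comm hF
  change ∫ x, f x ∂μ = _ at this
  rw [this]
  exact (∫ x, F x ∂μ).2

section Hilbert

variable {H : Type*} [NormedAddCommGroup H] [InnerProductSpace ℂ H]

lemma isCompactOperator_rankOne (x y : H) :
    IsCompactOperator (InnerProductSpace.rankOne ℂ x y) := by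
  rw [InnerProductSpace.rankOne_def']
  have h : IsCompactOperator ⇑(ContinuousLinearMap.toSpanSingleton ℂ x) :=
    isCompactOperator_of_locallyCompactSpace_rng _
  exact h.comp_clm (innerSL ℂ y)

lemma continuous_rankOne_self : Continuous fun x : H => InnerProductSpace.rankOne ℂ x x := by
  have h : ∀ x y : H, InnerProductSpace.rankOne ℂ x y
    = ContinuousLinearMap.smulRightL ℂ H H (innerSL ℂ y) x := fun _ _ => rfl
  simp only [h]
  fun_prop

lemma aestronglyMeasurable_rankOne {X : Type*} [MeasurableSpace X] {μ : Measure X} {u : X → H}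
    (hu : AEStronglyMeasurable u μ) :
    AEStronglyMeasurable (fun x => InnerProductSpace.rankOne ℂ (u x) (u x)) μ :=
  Continuous.comp_aestronglyMeasurable (g := fun x : H => InnerProductSpace.rankOne ℂ x x)
    continuous_rankOne_self hu

variable [CompleteSpace H]

lemma inner_apply_apply_eq_inner_abs (A : H →L[ℂ] H) (x y : H) :
    inner ℂ (A x) (A y) = inner ℂ ((CFC.abs A : H →L[ℂ] H) x) ((CFC.abs A : H →L[ℂ] H) y) := by
  have hsa : IsSelfAdjoint (CFC.abs A : H →L[ℂ] H) := (CFC.abs_nonneg A).isSelfAdjoint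
  rw [← ContinuousLinearMap.adjoint_inner_right, ← ContinuousLinearMap.adjoint_inner_right,
    ← ContinuousLinearMap.star_eq_adjoint, ← ContinuousLinearMap.star_eq_adjoint, hsa.star_eq]
  have := congrArg (fun T : H →L[ℂ] H => T y) (CFC.abs_mul_abs A)
  simp only [mul_apply_eq_comp] at this
  rw [this]

/-- To bound the trace norm it suffices to bound the traces `∑ ⟨vᵢ, A eᵢ⟩` over finite orthonormal
families. -/
lemma s1Norm_le_of_forall_orthonormal (A : H →L[ℂ] H) (B : ℝ≥0∞)
    (hB : ∀ (ι : Type) [Fintype ι] (v e : ι → H), Orthonormal ℂ v → Orthonormal ℂ e →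
      ‖∑ i, inner ℂ (v i) (A (e i))‖ₑ ≤ B) : s1Norm A ≤ B := by
  classical
  set T : H →L[ℂ] H := CFC.abs A with hT
  have hsa : IsSelfAdjoint T := (CFC.abs_nonneg A).isSelfAdjoint
  have hsymm : (T : H →ₗ[ℂ] H).IsSymmetric := hsa.isSymmetric
  have hbasis : ∀ s : ℂ, ∃ b : Fin (Module.finrank ℂ (Module.End.eigenspace (T : H →ₗ[ℂ] H) s)) →
      Module.End.eigenspace (T : H →ₗ[ℂ] H) s, Orthonormal ℂ b := by
    intro s
    -- An infinite-dimensional eigenspace has `finrank` equal to `0`; it contributes nothing to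
    -- `s1Norm`, and the empty family serves.
    rcases Nat.eq_zero_or_pos
      (Module.finrank ℂ (Module.End.eigenspace (T : H →ₗ[ℂ] H) s)) with h | h
    · have : IsEmpty (Fin (Module.finrank ℂ (Module.End.eigenspace (T : H →ₗ[ℂ] H) s))) := by
        rw [h]; infer_instance
      exact ⟨isEmptyElim, ⟨isEmptyElim, fun i => isEmptyElim i⟩⟩
    · have := Module.finite_of_finrank_pos h
      exact ⟨_, (stdOrthonormalBasis ℂ _).orthonormal⟩
  choose b hb using hbasis
  rw [s1Norm, ENNReal.tsum_eq_iSup_sum]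
  refine iSup_le fun S => ?_
  set ι : Type := Σ s : S, Fin (Module.finrank ℂ
    (Module.End.eigenspace (T : H →ₗ[ℂ] H) ((s.1.1 : ℝ) : ℂ))) with hι
  let e : ι → H := fun i => b ((i.1.1.1 : ℝ) : ℂ) i.2
  have he : Orthonormal ℂ e := by
    have hinj : Function.Injective fun s : S => ((s.1.1 : ℝ) : ℂ) := fun s t h =>
      Subtype.ext (Subtype.ext (Complex.ofReal_injective h))
    exact (hsymm.orthogonalFamily_eigenspaces.comp hinj).orthonormal_sigma_orthonormal
      fun s => hb _
  have hpos : ∀ i : ι, 0 < i.1.1.1 := fun i => i.1.1.2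
  have hTe : ∀ i, T (e i) = ((i.1.1.1 : ℝ) : ℂ) • e i := fun i =>
    Module.End.mem_eigenspace_iff.mp (b ((i.1.1.1 : ℝ) : ℂ) i.2).2
  have hAA : ∀ i j, inner ℂ (A (e i)) (A (e j))
      = if i = j then ((i.1.1.1 : ℝ) : ℂ) ^ 2 else 0 := by
    intro i j
    rw [inner_apply_apply_eq_inner_abs, hTe, hTe, inner_smul_left, inner_smul_right,
      orthonormal_iff_ite.mp he i j]
    split_ifs with h
    · simp [h, sq]
    · simp
  -- Polar decomposition by hand: with `e` orthonormal eigenvectors of `|A|`, the vectors `A eᵢ /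
  -- sᵢ` are orthonormal because `A` and `|A|` give the same inner products, and `⟨vᵢ, A eᵢ⟩ = sᵢ`.
  let v : ι → H := fun i => (((i.1.1.1 : ℝ) : ℂ))⁻¹ • A (e i)
  have hne : ∀ i : ι, ((i.1.1.1 : ℝ) : ℂ) ≠ 0 := fun i => Complex.ofReal_ne_zero.mpr (hpos i).ne'
  have hv : Orthonormal ℂ v := by
    rw [orthonormal_iff_ite]
    intro i j
    simp only [v, inner_smul_left, inner_smul_right, hAA]
    split_ifs with h
    · subst h
      have := hne i
      simp only [map_inv₀, Complex.conj_ofReal]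
      field_simp
    · simp
  have hsum : ∑ i, inner ℂ (v i) (A (e i)) = ((∑ i : ι, i.1.1.1 : ℝ) : ℂ) := by
    rw [Complex.ofReal_sum]
    refine Finset.sum_congr rfl fun i _ => ?_
    have := hne i
    simp only [v, inner_smul_left, hAA, if_true, map_inv₀, Complex.conj_ofReal]
    field_simp
  have h := hB ι v e hv he
  rw [hsum, ← ofReal_norm, Complex.norm_real,
    Real.norm_of_nonneg (Finset.sum_nonneg fun i _ => (hpos i).le),
    ENNReal.ofReal_sum_of_nonneg (fun i _ => (hpos i).le)] at h
  refine le_trans (le_of_eq ?_) h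
  rw [Fintype.sum_sigma, ← Finset.sum_coe_sort]
  refine Finset.sum_congr rfl fun s _ => ?_
  simp only [Finset.sum_const, Finset.card_univ, Fintype.card_fin, nsmul_eq_mul]
  exact mul_comm _ _

variable {X : Type*} [MeasurableSpace X] {μ : Measure X} {s : X → ℂ} {u : X → H} {R : ℝ}

lemma integrable_smul_rankOne (hs : Integrable s μ) (hu : AEStronglyMeasurable u μ)
    (hR : ∀ x, ‖u x‖ ≤ R) :
    Integrable (fun x => s x • InnerProductSpace.rankOne ℂ (u x) (u x)) μ := by
  have hm := aestronglyMeasurable_rankOne hu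
  refine hs.smul_bdd (R * R) hm (Eventually.of_forall fun x => ?_)
  rw [InnerProductSpace.norm_rankOne]
  exact mul_le_mul (hR x) (hR x) (norm_nonneg _) ((norm_nonneg _).trans (hR x))

lemma isCompactOperator_integral_rankOne (hs : Integrable s μ) (hu : AEStronglyMeasurable u μ)
    (hR : ∀ x, ‖u x‖ ≤ R) :
    IsCompactOperator ⇑(∫ x, s x • InnerProductSpace.rankOne ℂ (u x) (u x) ∂μ : H →L[ℂ] H) := by
  have hK : IsClosed ((compactOperator (RingHom.id ℂ) H H : Submodule ℂ (H →L[ℂ] H)) :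
      Set (H →L[ℂ] H)) := isClosed_setOfPred_isCompactOperator
  exact integral_mem_of_isClosed hK (integrable_smul_rankOne hs hu hR) fun x =>
    Submodule.smul_mem _ _ (isCompactOperator_rankOne _ _)

lemma s1Norm_integral_rankOne_le (hs : Integrable s μ) (hu : AEStronglyMeasurable u μ)
    (hR : ∀ x, ‖u x‖ ≤ R) :
    s1Norm (∫ x, s x • InnerProductSpace.rankOne ℂ (u x) (u x) ∂μ)
      ≤ (∫⁻ x, ‖s x‖ₑ ∂μ) * ENNReal.ofReal (R ^ 2) := by
  refine s1Norm_le_of_forall_orthonormal _ _ fun ι _ v e hv he => ?_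
  let φ : (H →L[ℂ] H) →L[ℂ] ℂ :=
    ∑ i, (innerSL ℂ (v i)).comp (ContinuousLinearMap.apply ℂ H (e i))
  have hφ : ∀ T : H →L[ℂ] H, φ T = ∑ i, inner ℂ (v i) (T (e i)) := fun T => by
    simp [φ]
  rw [← hφ, ← φ.integral_comp_comm (integrable_smul_rankOne hs hu hR),
    ← lintegral_mul_const' _ _ ENNReal.ofReal_ne_top]
  refine (enorm_integral_le_lintegral_enorm _).trans (lintegral_mono fun x => ?_)
  rw [map_smul, enorm_smul]
  gcongr
  rw [← ofReal_norm]
  refine ENNReal.ofReal_le_ofReal ?_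
  rw [hφ]
  -- For a rank-one operator the trace splits into products; the arithmetic–geometric mean and
  -- Bessel's inequality for `v` and for `e` bound it by `‖u x‖²`.
  calc ‖∑ i, inner ℂ (v i) (InnerProductSpace.rankOne ℂ (u x) (u x) (e i))‖
      ≤ ∑ i, (‖inner ℂ (v i) (u x)‖ ^ 2 + ‖inner ℂ (e i) (u x)‖ ^ 2) / 2 := by
        refine norm_sum_le_of_le _ fun i _ => ?_
        rw [InnerProductSpace.inner_right_rankOne_apply, norm_mul, norm_inner_symm (u x) (e i)]
        nlinarith [sq_nonneg (‖inner ℂ (v i) (u x)‖ - ‖inner ℂ (e i) (u x)‖)]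
    _ ≤ (‖u x‖ ^ 2 + ‖u x‖ ^ 2) / 2 := by
        rw [← Finset.sum_div, Finset.sum_add_distrib]
        gcongr
        · exact hv.sum_inner_products_le (u x)
        · exact he.sum_inner_products_le (u x)
    _ ≤ R ^ 2 := by
        have := pow_le_pow_left₀ (norm_nonneg _) (hR x) 2
        linarith

end Hilbert

/-! ### Localization operators with integrable symbols -/

/-- The localization operator with symbol `ς` and window `g`, as a Bochner integral of rank-one
operators. -/
noncomputable def locCLM (ς : Zn n × Tn n → ℂ) (g : ellTwo n) : ellTwo n →L[ℂ] ellTwo n :=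
  ∫ z, ς z • InnerProductSpace.rankOne ℂ (tfShift g z) (tfShift g z) ∂(muZT n)

section

variable {ς : Zn n × Tn n → ℂ} (hς : Integrable ς (muZT n)) (g : ellTwo n)
/-- Evaluation of `A f` at `k`, as a continuous linear functional of the operator `A`. -/
noncomputable def evalCLM (f : ellTwo n) (k : Zn n) : (ellTwo n →L[ℂ] ellTwo n) →L[ℂ] ℂ :=
  (lp.evalCLM ℂ (fun _ : Zn n => ℂ) 2 k).comp (ContinuousLinearMap.apply ℂ (ellTwo n) f)

lemma evalCLM_rankOne (f : ellTwo n) (k : Zn n) (z : Zn n × Tn n) :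
    evalCLM f k (ς z • InnerProductSpace.rankOne ℂ (tfShift g z) (tfShift g z))
      = locIntegrand ς g g f k z := by
  change (ς z • (inner ℂ (tfShift g z) f • tfShift g z) : ellTwo n) k = _
  rw [lp.coeFn_smul, Pi.smul_apply, lp.coeFn_smul, Pi.smul_apply, inner_tfShift, locIntegrand,
    tfShift_apply, smul_eq_mul, smul_eq_mul, mul_assoc]

include hς

lemma integrable_locCLM : Integrable (fun z =>
    ς z • InnerProductSpace.rankOne ℂ (tfShift g z) (tfShift g z)) (muZT n) :=
  integrable_smul_rankOne hς (continuous_tfShift g).aestronglyMeasurable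
    fun z => (norm_tfShift g z).le

lemma integrable_locIntegrand (f : ellTwo n) (k : Zn n) :
    Integrable (locIntegrand ς g g f k) (muZT n) := by
  have h := (evalCLM f k).integrable_comp (integrable_locCLM hς g)
  simpa only [evalCLM_rankOne] using h

lemma locCLM_apply (f : ellTwo n) (k : Zn n) : locCLM ς g f k = locOp ς g g f k := by
  change evalCLM f k (locCLM ς g) = _
  have hi := integrable_locIntegrand hς g f k
  rw [locCLM, ← (evalCLM f k).integral_comp_comm (integrable_locCLM hς g)]
  simp only [evalCLM_rankOne]
  rw [muZT] at hi ⊢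
  rw [integral_prod _ hi, integral_countable hi.integral_prod_left, locOp]
  simp

lemma isCompactOperator_locCLM : IsCompactOperator ⇑(locCLM ς g) :=
  isCompactOperator_integral_rankOne hς (continuous_tfShift g).aestronglyMeasurable
    fun z => (norm_tfShift g z).le

lemma s1Norm_locCLM_le : s1Norm (locCLM ς g) ≤ (∫⁻ z, ‖ς z‖ₑ ∂(muZT n)) * ‖g‖ₑ ^ 2 := by
  have := s1Norm_integral_rankOne_le hς (continuous_tfShift g).aestronglyMeasurable
    fun z => (norm_tfShift g z).le
  rwa [ENNReal.ofReal_pow (norm_nonneg _), ofReal_norm] at this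

end

end OrliczLoc

theorem mainTheorem5 (n : ℕ)
    (Φ : ENNReal → ENNReal) (hΦ : OrliczLoc.IsYoung Φ) (hΦ₀ : OrliczLoc.EntropyNearZero Φ)
    -- the fixed non-zero windows that define the norms of `M¹(ℤⁿ × 𝕋ⁿ)` and of `M^Φ(ℤⁿ)`
    (γ : OrliczLoc.Zn n × OrliczLoc.Tn n → ℂ) (hγ : OrliczLoc.IsSchwartzZT γ) (hγ₀ : γ ≠ 0)
    (g₀ : OrliczLoc.Zn n → ℂ) (hg₀ : OrliczLoc.IsSchwartzZ g₀) (hg₀' : g₀ ≠ 0)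
    (ς : OrliczLoc.Zn n × OrliczLoc.Tn n → ℂ) (hς : OrliczLoc.MemM1 γ ς)
    (g : OrliczLoc.Zn n → ℂ) (hg : OrliczLoc.MemMPhi Φ g₀ g) :
    -- the series and integrals that define the operator converge absolutely on `ℓ²(ℤⁿ)`
    (∀ (f : OrliczLoc.ellTwo n) (m : OrliczLoc.Zn n), Summable fun k => f k * conj (g (k - m))) ∧
    (∀ (f : OrliczLoc.ellTwo n) (k : OrliczLoc.Zn n),
      Integrable (OrliczLoc.locIntegrand ς g g f k) (OrliczLoc.muZT n)) ∧
    -- the operator they define is a bounded operator of trace class, with the norm estimate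
    ∃ L : OrliczLoc.ellTwo n →L[ℂ] OrliczLoc.ellTwo n,
      (∀ (f : OrliczLoc.ellTwo n) (k : OrliczLoc.Zn n), L f k = OrliczLoc.locOp ς g g f k) ∧
      OrliczLoc.MemS1 L ∧
      (4 ≤ 3 * (⨆ p, ‖γ p‖ₑ) * ∑' k, ‖g₀ k‖ₑ ^ 2 →
        OrliczLoc.s1Norm L ≤ 4 * OrliczLoc.m1Norm γ ς * OrliczLoc.mPhiNorm Φ g₀ g ^ 2) ∧
      (3 * (⨆ p, ‖γ p‖ₑ) * (∑' k, ‖g₀ k‖ₑ ^ 2) * OrliczLoc.s1Norm L ≤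
        4 * (4 * OrliczLoc.m1Norm γ ς * OrliczLoc.mPhiNorm Φ g₀ g ^ 2)) := by
  have hg2 := hg.memℓp hΦ hΦ₀ hg₀ hg₀'
  set G : OrliczLoc.ellTwo n := ⟨g, hg2⟩ with hG
  set G₀ : OrliczLoc.ellTwo n := ⟨g₀, hg₀.memℓp⟩ with hG₀
  have hM1 := OrliczLoc.iSup_enorm_mul_lintegral_le_m1Norm hγ hς
  have hMΦ : 3 * (‖G₀‖ₑ ^ 2 * ‖G‖ₑ ^ 2) ≤ 16 * OrliczLoc.mPhiNorm Φ g₀ g ^ 2 :=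
    OrliczLoc.three_mul_enorm_sq_le_mPhiNorm hΦ hΦ₀ G₀ G
  have hg₀sum : ∑' k, ‖g₀ k‖ₑ ^ 2 = ‖G₀‖ₑ ^ 2 := OrliczLoc.tsum_enorm_sq G₀
  have hm1 : OrliczLoc.m1Norm γ ς < ∞ := hς.2.2
  have hint : Integrable ς (OrliczLoc.muZT n) := by
    refine ⟨hς.1.1, ?_⟩
    -- With a positive supremum, `‖ς‖₁ = ∞` would force `‖ς‖_{M¹} = ∞`.
    have hpos : (⨆ p, ‖γ p‖ₑ) ≠ 0 := by
      obtain ⟨p, hp⟩ := Function.ne_iff.mp hγ₀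
      exact fun h0 => hp (by simpa using (ENNReal.iSup_eq_zero.mp h0) p)
    by_contra htop
    rw [HasFiniteIntegral, not_lt, top_le_iff] at htop
    rw [htop, ENNReal.mul_top hpos] at hM1
    exact absurd hm1 hM1.not_gt
  have hS1 := OrliczLoc.s1Norm_locCLM_le hint G
  have hmain : 3 * (⨆ p, ‖γ p‖ₑ) * (∑' k, ‖g₀ k‖ₑ ^ 2) * OrliczLoc.s1Norm (OrliczLoc.locCLM ς G) ≤
      4 * (4 * OrliczLoc.m1Norm γ ς * OrliczLoc.mPhiNorm Φ g₀ g ^ 2) := by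
    rw [hg₀sum]
    calc 3 * (⨆ p, ‖γ p‖ₑ) * ‖G₀‖ₑ ^ 2 * OrliczLoc.s1Norm (OrliczLoc.locCLM ς G)
        ≤ 3 * (⨆ p, ‖γ p‖ₑ) * ‖G₀‖ₑ ^ 2 * ((∫⁻ z, ‖ς z‖ₑ ∂(OrliczLoc.muZT n)) * ‖G‖ₑ ^ 2) := by
          gcongr
      _ = (3 * (‖G₀‖ₑ ^ 2 * ‖G‖ₑ ^ 2)) * ((⨆ p, ‖γ p‖ₑ) * ∫⁻ z, ‖ς z‖ₑ ∂(OrliczLoc.muZT n)) := by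
          ring
      _ ≤ (16 * OrliczLoc.mPhiNorm Φ g₀ g ^ 2) * OrliczLoc.m1Norm γ ς := mul_le_mul' hMΦ hM1
      _ = _ := by ring
  refine ⟨fun f m => OrliczLoc.summable_mul_conj_translate f G m,
    fun f k => OrliczLoc.integrable_locIntegrand hint G f k,
    OrliczLoc.locCLM ς G, fun f k => OrliczLoc.locCLM_apply hint G f k,
    ⟨OrliczLoc.isCompactOperator_locCLM hint G, hS1.trans_lt ?_⟩, fun hnorm => ?_, hmain⟩
  · exact ENNReal.mul_lt_top hint.2 (ENNReal.pow_lt_top enorm_lt_top)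
  -- The normalization replaces the window factor in `hmain` by `4`, which cancels the outer `4`.
  · rw [← ENNReal.mul_le_mul_iff_right (a := 4) (by norm_num) (by norm_num)]
    refine le_trans ?_ hmain
    gcongr
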